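/- All graphs are simple (and may be finite or infinite); a graph is subcubic if each of its vertices has degree at most $3$. The subdivided graph $S(G)$ of a graph $G$ is obtained from $G$ by replacing each edge by a path of length two. For a non-decreasing sequence of positive integers $(s_1,\ldots,s_k)$, a graph $H$ is $(s_1,\ldots,s_k)$-colorable if there is a map $c:V(H)\to\{1,\ldots,k\}$ such that any two distinct vertices $u,v$ with $c(u)=c(v)=i$ satisfy $d_H(u,v)>s_i$ (vertices in different components being at infinite distance). The packing chromatic number $\chi_\rho(H)$ is the least $k$ such that $H$ is $(1,2,\ldots,k)$-colorable. For every subcubic graph $G$, the subdivided graph $S(G)$ is $(1,3,3,5,5,7)$-colorable; in particular, $\chi_\rho(S(G))\le 6$. -/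

import Mathlib

namespace SimpleGraph

variable {V : Type*}

/-- A graph is subcubic if every vertex has at most three neighbours. -/
def IsSubcubic (G : SimpleGraph V) : Prop :=
  ∀ v : V, (G.neighborSet v).encard ≤ 3

/-- The subdivided graph `S(G)`: every edge of `G` is replaced by a path of length two.
Its vertices are the original vertices `Sum.inl v` and one subdivision vertex `Sum.inr e` for each
edge `e` of `G`, which is adjacent to the two ends of `e`. -/
def subdivided (G : SimpleGraph V) : SimpleGraph (V ⊕ G.edgeSet) where
  Adj
    | .inl v, .inr e => v ∈ e.1
    | .inr e, .inl v => v ∈ e.1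
    | .inl _, .inl _ => False
    | .inr _, .inr _ => False
  symm := ⟨by rintro (v | e) (w | f) h <;> exact h⟩
  loopless := ⟨by rintro (v | e) h <;> exact h⟩

/-- `c` is an `S`-packing coloring of `G`, for `S = (s 0, …, s (k - 1))`: any two distinct vertices
with the same color `i` are at distance greater than `s i`. The colors are the indices of the
sequence, so that equal entries of `S` are different colors; vertices in different components are
at infinite distance. -/
def IsPackingColoring (G : SimpleGraph V) {k : ℕ} (s : Fin k → ℕ) (c : V → Fin k) : Prop :=
  ∀ u v : V, u ≠ v → c u = c v → (s (c u) : ℕ∞) < G.edist u v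

/-- `G` is `S`-colorable. -/
def PackingColorable (G : SimpleGraph V) {k : ℕ} (s : Fin k → ℕ) : Prop :=
  ∃ c : V → Fin k, G.IsPackingColoring s c

/-- The packing chromatic number: the least `k` such that `G` is `(1, 2, …, k)`-colorable
(`⊤` if there is none). -/
noncomputable def packingChromaticNumber (G : SimpleGraph V) : ℕ∞ :=
  ⨅ k ∈ {k : ℕ | G.PackingColorable fun i : Fin k => (i : ℕ) + 1}, (k : ℕ∞)

end SimpleGraph

set_option linter.unusedSectionVars false

namespace SubcubicPacking

variable {V : Type*}

/-! ### Counting related pairs -/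

/-! It suffices to colour `G` itself with distance bounds (1, 1, 2, 2, 3). Subdivision doubles
distances, so distance more than s becomes distance at least 2s + 2 > 2s + 1, and the subdivision
vertices are pairwise nonadjacent and share the colour of bound 1.

Let `G` be finite and `σ` a maximum cut. Its monochromatic edges form a matching, so the two sides
serve as the classes of bound 1 once an end of each such edge has moved to the classes of bound 2,
2, 3. Maximality enters through `excess`: on a set without inner monochromatic edge it is at least
`margin`, the number of monochromatic edges gained by switching the set, hence nonnegative. If it is
zero, switching gives another maximum cut. It is also submodular, so sets without excess can be
uncrossed (`uncross`).

An admissible selection `Y` takes at most one end of each monochromatic edge. Counting shows that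
every nonempty subset of `Y` has a vertex `Linked` to at most one other (`exists_linked_le_one`), so
`Linked` can be two-coloured on `Y`. For selected vertices that are not sources (the `core`), being
at distance at most 2 implies `Linked`, so the core fits into the two classes of bound 2.

Each monochromatic edge that misses the core puts one end into the class of bound 3. To see that
these ends are far apart, choose `Y` of maximum size over all maximum cuts, and then with fewest
sources. Now every end of such an edge is `Blocked`: it lies in a minimal set without excess.
Uncrossing makes the blocking sets of ends of different edges disjoint, with no bichromatic edge
between them and no common bichromatic neighbour. The only remaining short connection is a
bichromatic path e v w f with v and w uncovered. Then the two blocking sets together with v and w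
have no excess, and switching along them gives a larger selection or an equally large one with fewer
sources (`Optimal.not_path`).

Infinite graphs follow by compactness (`exists_coloring`). -/

open Classical in
/-- The number of pairs in `S × T` related by `r`, as an integer. -/
noncomputable def pairs (r : V → V → Prop) (S T : Finset V) : ℤ :=
  ∑ x ∈ S, ∑ y ∈ T, if r x y then 1 else 0

section pairs

variable {r s : V → V → Prop} {S S' T T' : Finset V} {x y : V}

lemma pairs_nonneg : 0 ≤ pairs r S T :=
  Finset.sum_nonneg fun _ _ => Finset.sum_nonneg fun _ _ => by split_ifs <;> simp

lemma pairs_comm (hr : ∀ x y, r x y → r y x) : pairs r S T = pairs r T S := by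
  classical
  unfold pairs
  rw [Finset.sum_comm]
  refine Finset.sum_congr rfl fun x _ => Finset.sum_congr rfl fun y _ => ?_
  exact if_congr ⟨hr _ _, hr _ _⟩ rfl rfl

@[simp] lemma pairs_empty_right : pairs r S ∅ = 0 := by simp [pairs]

lemma pairs_congr (h : ∀ x ∈ S, ∀ y ∈ T, (r x y ↔ s x y)) : pairs r S T = pairs s S T := by
  classical
  exact Finset.sum_congr rfl fun x hx => Finset.sum_congr rfl fun y hy =>
    if_congr (h x hx y hy) rfl rfl

lemma pairs_eq_zero (h : ∀ x ∈ S, ∀ y ∈ T, ¬ r x y) : pairs r S T = 0 :=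
  Finset.sum_eq_zero fun x hx => Finset.sum_eq_zero fun y hy => if_neg (h x hx y hy)

lemma one_le_pairs (hx : x ∈ S) (hy : y ∈ T) (h : r x y) : 1 ≤ pairs r S T := by
  classical
  calc (1 : ℤ) = if r x y then 1 else 0 := by simp [h]
    _ ≤ ∑ y ∈ T, if r x y then (1 : ℤ) else 0 :=
        Finset.single_le_sum (f := fun y => if r x y then (1 : ℤ) else 0)
          (fun _ _ => by split_ifs <;> simp) hy
    _ ≤ pairs r S T :=
        Finset.single_le_sum (f := fun x => ∑ y ∈ T, if r x y then (1 : ℤ) else 0)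
          (fun _ _ => Finset.sum_nonneg fun _ _ => by split_ifs <;> simp) hx

lemma forall_not_of_pairs_eq_zero (h : pairs r S T = 0) : ∀ x ∈ S, ∀ y ∈ T, ¬ r x y := by
  intro x hx y hy hr
  have := one_le_pairs hx hy hr
  omega

lemma pairs_eq_sum : pairs r S T = ∑ x ∈ S, pairs r {x} T := by simp [pairs]

lemma pairs_mono (hS : S ⊆ S') (hT : T ⊆ T') : pairs r S T ≤ pairs r S' T' := by
  classical
  refine (Finset.sum_le_sum fun x _ => Finset.sum_le_sum_of_subset_of_nonneg hT
    fun _ _ _ => ?_).trans (Finset.sum_le_sum_of_subset_of_nonneg hS fun _ _ _ => ?_)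
  · split_ifs <;> simp
  · exact Finset.sum_nonneg fun _ _ => by split_ifs <;> simp

variable [DecidableEq V]

lemma pairs_union_left (h : Disjoint S S') : pairs r (S ∪ S') T = pairs r S T + pairs r S' T := by
  simp [pairs, Finset.sum_union h]

lemma pairs_union_right (h : Disjoint T T') : pairs r S (T ∪ T') = pairs r S T + pairs r S T' := by
  simp [pairs, Finset.sum_union h, Finset.sum_add_distrib]

lemma pairs_singleton_eq_card [DecidableRel r] : pairs r {x} T = ((T.filter (r x)).card : ℤ) := by
  rw [← Finset.sum_boole, pairs, Finset.sum_singleton]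
  refine Finset.sum_congr rfl fun y _ => ?_
  by_cases h : r x y <;> simp [h]

lemma two_le_pairs {z : V} (hxy : x ≠ y) (hx : x ∈ T) (hy : y ∈ T) (hzx : r z x) (hzy : r z y) :
    2 ≤ pairs r {z} T := by
  classical
  rw [pairs_singleton_eq_card]
  have : ({x, y} : Finset V) ⊆ T.filter (r z) := by
    intro a ha
    simp only [Finset.mem_insert, Finset.mem_singleton] at ha
    rcases ha with rfl | rfl <;> simp [*]
  have := Finset.card_le_card this
  rw [Finset.card_pair hxy] at this
  exact_mod_cast this

lemma three_le_pairs {z u : V} (hxy : x ≠ y) (hxu : x ≠ u) (hyu : y ≠ u) (hx : x ∈ T) (hy : y ∈ T)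
    (hu : u ∈ T) (hzx : r z x) (hzy : r z y) (hzu : r z u) : 3 ≤ pairs r {z} T := by
  classical
  rw [pairs_singleton_eq_card]
  have : ({x, y, u} : Finset V) ⊆ T.filter (r z) := by
    intro a ha
    simp only [Finset.mem_insert, Finset.mem_singleton] at ha
    rcases ha with rfl | rfl | rfl <;> simp [*]
  have := Finset.card_le_card this
  rw [Finset.card_eq_three.2 ⟨x, y, u, hxy, hxu, hyu, rfl⟩] at this
  exact_mod_cast this

end pairs

/-! ### Monochromatic and bichromatic edges of a bipartition -/

variable (G : SimpleGraph V) (σ : V → Bool)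

/-- Adjacent vertices on the same side of the bipartition `σ`. -/
def Mono (x y : V) : Prop := G.Adj x y ∧ σ x = σ y

/-- Adjacent vertices on different sides of the bipartition `σ`. -/
def Cross (x y : V) : Prop := G.Adj x y ∧ σ x ≠ σ y

/-- Vertices on a monochromatic edge. -/
def Covered (x : V) : Prop := ∃ y, Mono G σ x y

/-- Sets that contain no monochromatic edge. -/
def MateFree (S : Finset V) : Prop := ∀ x ∈ S, ∀ y ∈ S, ¬ Mono G σ x y

open Classical in
/-- The number of degrees that a vertex can spend on a set it belongs to. -/
noncomputable def weight (x : V) : ℤ := if Covered G σ x then 1 else 3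

/-- The total weight of `S`, minus the number of ordered bichromatic edges inside `S`. -/
noncomputable def excess (S : Finset V) : ℤ := ∑ x ∈ S, weight G σ x - pairs (Cross G σ) S S

variable {G σ} {x y z : V} {S T : Finset V}

lemma Mono.symm (h : Mono G σ x y) : Mono G σ y x := ⟨h.1.symm, h.2.symm⟩

lemma Cross.symm (h : Cross G σ x y) : Cross G σ y x := ⟨h.1.symm, h.2.symm⟩

lemma Mono.covered (h : Mono G σ x y) : Covered G σ x := ⟨y, h⟩

lemma Mono.covered_right (h : Mono G σ x y) : Covered G σ y := ⟨x, h.symm⟩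

lemma Mono.not_cross (h : Mono G σ x y) : ¬ Cross G σ x y := fun h' => h'.2 h.2

lemma Cross.ne (h : Cross G σ x y) : x ≠ y := h.1.ne

lemma Mono.ne (h : Mono G σ x y) : x ≠ y := h.1.ne

lemma mono_or_cross (h : G.Adj x y) : Mono G σ x y ∨ Cross G σ x y := by
  by_cases hs : σ x = σ y
  · exact .inl ⟨h, hs⟩
  · exact .inr ⟨h, hs⟩

lemma weight_of_covered (h : Covered G σ x) : weight G σ x = 1 := if_pos h

lemma weight_of_not_covered (h : ¬ Covered G σ x) : weight G σ x = 3 := if_neg h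

lemma MateFree.subset (hT : MateFree G σ T) (h : S ⊆ T) : MateFree G σ S :=
  fun x hx y hy => hT x (h hx) y (h hy)

lemma pairs_cross_comm : pairs (Cross G σ) S T = pairs (Cross G σ) T S :=
  pairs_comm fun _ _ h => h.symm

lemma pairs_mono_comm : pairs (Mono G σ) S T = pairs (Mono G σ) T S :=
  pairs_comm fun _ _ h => h.symm

section Decidable

variable [DecidableEq V]

lemma excess_disjUnion (h : Disjoint S T) :
    excess G σ (S ∪ T) = excess G σ S + excess G σ T - 2 * pairs (Cross G σ) S T := by
  simp only [excess, Finset.sum_union h, pairs_union_left h, pairs_union_right h]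
  rw [pairs_cross_comm (S := T) (T := S)]
  ring

lemma excess_insert (h : x ∉ S) :
    excess G σ (insert x S) = excess G σ S + weight G σ x - 2 * pairs (Cross G σ) {x} S := by
  have h1 : pairs (Cross G σ) {x} {x} = 0 :=
    pairs_eq_zero fun a ha b hb hab => hab.ne (by simp_all)
  have h2 : excess G σ {x} = weight G σ x := by simp [excess, h1]
  rw [Finset.insert_eq, excess_disjUnion (by simpa using h), h2]
  ring

lemma excess_singleton : excess G σ {x} = weight G σ x := by
  have := excess_insert (G := G) (σ := σ) (x := x) (S := ∅) (by simp)
  simpa [excess] using this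

lemma excess_insert_le (h : x ∉ S) (hy : y ∈ S) (hxy : Cross G σ x y) :
    excess G σ (insert x S) ≤ excess G σ S + weight G σ x - 2 := by
  rw [excess_insert h]
  have := one_le_pairs (Finset.mem_singleton_self x) hy hxy
  omega

lemma excess_insert_le_of_two (h : x ∉ S) (hyz : y ≠ z) (hy : y ∈ S) (hz : z ∈ S)
    (hxy : Cross G σ x y) (hxz : Cross G σ x z) :
    excess G σ (insert x S) ≤ excess G σ S + weight G σ x - 4 := by
  rw [excess_insert h]
  have := two_le_pairs hyz hy hz hxy hxz
  omega

/-- Submodularity with its exact defect: twice the number of bichromatic edges between the two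
differences. All uncrossing rests on this. -/
lemma excess_union_add_excess_inter :
    excess G σ (S ∪ T) + excess G σ (S ∩ T) =
      excess G σ S + excess G σ T - 2 * pairs (Cross G σ) (S \ T) (T \ S) := by
  have e1 : S ∪ T = S ∪ (T \ S) := by simp
  have e2 : T = (S ∩ T) ∪ (T \ S) := by ext a; simp; tauto
  have d1 : Disjoint S (T \ S) := Finset.disjoint_sdiff
  have d2 : Disjoint (S ∩ T) (T \ S) := d1.mono_left Finset.inter_subset_left
  have e3 : S = (S ∩ T) ∪ (S \ T) := by ext a; simp; tauto
  have d3 : Disjoint (S ∩ T) (S \ T) := by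
    rw [Finset.disjoint_left]; intro a; simp; tauto
  have h1 := excess_disjUnion (G := G) (σ := σ) d1
  have h2 := excess_disjUnion (G := G) (σ := σ) d2
  rw [← e2] at h2
  have h3 : pairs (Cross G σ) S (T \ S) =
      pairs (Cross G σ) (S ∩ T) (T \ S) + pairs (Cross G σ) (S \ T) (T \ S) := by
    rw [← pairs_union_left d3, ← e3]
  rw [e1, h1, h2, h3]
  ring

/-! ### Switching a bipartition -/

/-- The bipartition obtained from `σ` by moving the vertices of `T` to the other side. -/
def switch (σ : V → Bool) (T : Finset V) (x : V) : Bool := if x ∈ T then !σ x else σ x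

lemma mono_switch_of_mem (hx : x ∈ T) (hy : y ∈ T) : Mono G (switch σ T) x y ↔ Mono G σ x y := by
  simp [Mono, switch, hx, hy]

lemma mono_switch_of_notMem (hx : x ∉ T) (hy : y ∉ T) :
    Mono G (switch σ T) x y ↔ Mono G σ x y := by
  simp [Mono, switch, hx, hy]

lemma mono_switch_left (hx : x ∈ T) (hy : y ∉ T) : Mono G (switch σ T) x y ↔ Cross G σ x y := by
  cases h : σ x <;> cases h' : σ y <;> simp [Mono, Cross, switch, hx, hy, h, h']

lemma mono_switch_right (hx : x ∉ T) (hy : y ∈ T) : Mono G (switch σ T) x y ↔ Cross G σ x y := by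
  cases h : σ x <;> cases h' : σ y <;> simp [Mono, Cross, switch, hx, hy, h, h']

lemma cross_switch_of_mem (hx : x ∈ T) (hy : y ∈ T) :
    Cross G (switch σ T) x y ↔ Cross G σ x y := by
  simp [Cross, switch, hx, hy]

lemma cross_switch_of_notMem (hx : x ∉ T) (hy : y ∉ T) :
    Cross G (switch σ T) x y ↔ Cross G σ x y := by
  simp [Cross, switch, hx, hy]

lemma cross_switch_left (hx : x ∈ T) (hy : y ∉ T) : Cross G (switch σ T) x y ↔ Mono G σ x y := by
  cases h : σ x <;> cases h' : σ y <;> simp [Mono, Cross, switch, hx, hy, h, h']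

lemma cross_switch_right (hx : x ∉ T) (hy : y ∈ T) : Cross G (switch σ T) x y ↔ Mono G σ x y := by
  cases h : σ x <;> cases h' : σ y <;> simp [Mono, Cross, switch, hx, hy, h, h']

variable [Fintype V]

/-- The bipartition has as few monochromatic edges as possible. -/
def IsMaxCut (G : SimpleGraph V) (σ : V → Bool) : Prop :=
  ∀ τ : V → Bool, pairs (Mono G σ) .univ .univ ≤ pairs (Mono G τ) .univ .univ

/-- The number of bichromatic minus the number of monochromatic edges leaving `S`. -/
noncomputable def margin (G : SimpleGraph V) (σ : V → Bool) (S : Finset V) : ℤ :=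
  pairs (Cross G σ) S Sᶜ - pairs (Mono G σ) S Sᶜ

lemma pairs_univ_split {r : V → V → Prop} (T : Finset V) :
    pairs r .univ .univ = pairs r T T + pairs r T Tᶜ + pairs r Tᶜ T + pairs r Tᶜ Tᶜ := by
  have h : (Finset.univ : Finset V) = T ∪ Tᶜ := by simp
  have d : Disjoint T Tᶜ := disjoint_compl_right
  rw [h, pairs_union_left d, pairs_union_right d, pairs_union_right d]
  ring

lemma pairs_univ_right {r : V → V → Prop} (S T : Finset V) :
    pairs r S .univ = pairs r S T + pairs r S Tᶜ := by
  rw [← pairs_union_right disjoint_compl_right]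
  simp

/-- Only edges leaving `T` change type, and each is counted in both directions, hence the factor 2.
-/
lemma pairs_mono_switch (T : Finset V) :
    pairs (Mono G (switch σ T)) .univ .univ =
      pairs (Mono G σ) .univ .univ + 2 * margin G σ T := by
  rw [pairs_univ_split T, pairs_univ_split (r := Mono G σ) T, margin]
  rw [pairs_congr (S := T) (T := T) fun x hx y hy => mono_switch_of_mem hx hy,
    pairs_congr (S := T) (T := Tᶜ) fun x hx y hy => mono_switch_left hx (by simpa using hy),
    pairs_congr (S := Tᶜ) (T := T) fun x hx y hy => mono_switch_right (by simpa using hx) hy,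
    pairs_congr (S := Tᶜ) (T := Tᶜ) fun x hx y hy =>
      mono_switch_of_notMem (by simpa using hx) (by simpa using hy)]
  rw [pairs_cross_comm (S := Tᶜ), pairs_mono_comm (S := Tᶜ) (T := T)]
  ring

lemma IsMaxCut.margin_nonneg (h : IsMaxCut G σ) (S : Finset V) : 0 ≤ margin G σ S := by
  have := h (switch σ S)
  rw [pairs_mono_switch] at this
  omega

lemma IsMaxCut.switch (h : IsMaxCut G σ) (hT : margin G σ T = 0) :
    IsMaxCut G (SubcubicPacking.switch σ T) := by
  intro τ
  rw [pairs_mono_switch, hT]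
  simpa using h τ

variable (G) in
lemma exists_isMaxCut : ∃ σ, IsMaxCut G σ :=
  Finite.exists_min fun σ : V → Bool => pairs (Mono G σ) .univ .univ

/-! ### Maximum cuts of subcubic graphs -/

lemma pairs_adj (G : SimpleGraph V) (σ : V → Bool) (S T : Finset V) :
    pairs G.Adj S T = pairs (Cross G σ) S T + pairs (Mono G σ) S T := by
  classical
  simp only [pairs, ← Finset.sum_add_distrib]
  refine Finset.sum_congr rfl fun x _ => Finset.sum_congr rfl fun y _ => ?_
  by_cases h : G.Adj x y <;> by_cases h' : σ x = σ y <;> simp [Cross, Mono, h, h']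

lemma pairs_adj_le_three (hG : G.IsSubcubic) (x : V) (S : Finset V) : pairs G.Adj {x} S ≤ 3 := by
  classical
  rw [pairs_singleton_eq_card]
  have h1 : ((S.filter (G.Adj x) : Finset V) : Set V) ⊆ G.neighborSet x := by
    intro y; simp
  have h2 := (Set.encard_le_encard h1).trans (hG x)
  rw [Set.encard_coe_eq_coe_finsetCard] at h2
  exact_mod_cast h2

/-- If two of the at most three edges at `x` were monochromatic, moving `x` alone would improve the
cut. So the monochromatic edges form a matching. -/
lemma pairs_mono_le_one (hG : G.IsSubcubic) (h : IsMaxCut G σ) (x : V) (S : Finset V) :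
    pairs (Mono G σ) {x} S ≤ 1 := by
  have h1 := h.margin_nonneg {x}
  have h2 := pairs_adj_le_three hG x .univ
  rw [pairs_adj G σ] at h2
  have h3 := pairs_univ_right (r := Cross G σ) {x} {x}
  have h4 := pairs_univ_right (r := Mono G σ) {x} {x}
  have h5 : pairs (Mono G σ) {x} {x} = 0 :=
    pairs_eq_zero fun a ha b hb hab => hab.ne (by simp_all)
  have h6 : pairs (Mono G σ) {x} S ≤ pairs (Mono G σ) {x} .univ :=
    pairs_mono subset_rfl (Finset.subset_univ _)
  have h7 := pairs_nonneg (r := Cross G σ) (S := {x}) (T := {x})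
  have h8 : pairs (Cross G σ) {x} {x} = 0 :=
    pairs_eq_zero fun a ha b hb hab => hab.ne (by simp_all)
  rw [margin] at h1
  omega

lemma mono_unique (hG : G.IsSubcubic) (h : IsMaxCut G σ) (hy : Mono G σ x y) (hz : Mono G σ x z) :
    y = z := by
  by_contra hne
  have h1 := pairs_mono_le_one hG h x .univ
  have h2 := two_le_pairs hne (Finset.mem_univ _) (Finset.mem_univ _) hy hz
  omega

lemma weight_eq (hG : G.IsSubcubic) (h : IsMaxCut G σ) (x : V) :
    weight G σ x = 3 - 2 * pairs (Mono G σ) {x} .univ := by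
  by_cases hx : Covered G σ x
  · obtain ⟨y, hy⟩ := hx
    have h1 := pairs_mono_le_one hG h x .univ
    have h2 := one_le_pairs (Finset.mem_singleton_self x) (Finset.mem_univ _) hy
    rw [weight_of_covered ⟨y, hy⟩]
    omega
  · rw [weight_of_not_covered hx, pairs_eq_zero]
    · simp
    · intro a ha b _ hab
      obtain rfl : a = x := by simpa using ha
      exact hx ⟨b, hab⟩

/-- By `weight_eq`, a weight is the bichromatic minus the monochromatic degree, plus the degree
deficiency. The edges inside `S` are all bichromatic and cancel, which leaves the margin. -/
lemma excess_eq (hG : G.IsSubcubic) (h : IsMaxCut G σ) (hS : MateFree G σ S) :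
    excess G σ S = margin G σ S + ∑ x ∈ S, (3 - pairs G.Adj {x} .univ) := by
  have h1 : ∑ x ∈ S, weight G σ x = ∑ x ∈ S, (3 - pairs G.Adj {x} .univ) +
      pairs (Cross G σ) S .univ - pairs (Mono G σ) S .univ := by
    rw [pairs_eq_sum (r := Cross G σ), pairs_eq_sum (r := Mono G σ), ← Finset.sum_add_distrib,
      ← Finset.sum_sub_distrib]
    refine Finset.sum_congr rfl fun x _ => ?_
    rw [weight_eq hG h, pairs_adj G σ]
    ring
  have h2 : pairs (Mono G σ) S S = 0 := pairs_eq_zero hS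
  rw [excess, h1, pairs_univ_right S S, pairs_univ_right S S, h2, margin]
  ring

lemma margin_le_excess (hG : G.IsSubcubic) (h : IsMaxCut G σ) (hS : MateFree G σ S) :
    margin G σ S ≤ excess G σ S := by
  rw [excess_eq hG h hS]
  have : 0 ≤ ∑ x ∈ S, (3 - pairs G.Adj {x} .univ) :=
    Finset.sum_nonneg fun x _ => by linarith [pairs_adj_le_three hG x .univ]
  omega

lemma excess_nonneg (hG : G.IsSubcubic) (h : IsMaxCut G σ) (hS : MateFree G σ S) :
    0 ≤ excess G σ S :=
  (h.margin_nonneg S).trans (margin_le_excess hG h hS)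

/-- A path of three covered vertices along bichromatic edges has monochromatic ends. -/
lemma mono_of_cross_of_cross (hG : G.IsSubcubic) (h : IsMaxCut G σ) (hx : Covered G σ x)
    (hy : Covered G σ y) (hz : Covered G σ z) (hxy : Cross G σ x y) (hyz : Cross G σ y z)
    (hxz : x ≠ z) : Mono G σ x z := by
  by_contra hm
  have hmf : MateFree G σ {y, x, z} := by
    intro a ha b hb hab
    simp only [Finset.mem_insert, Finset.mem_singleton] at ha hb
    rcases ha with rfl | rfl | rfl <;> rcases hb with rfl | rfl | rfl <;>
      first
      | exact hab.ne rfl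
      | exact hm hab
      | exact hm hab.symm
      | exact hab.not_cross hxy
      | exact hab.not_cross hxy.symm
      | exact hab.not_cross hyz
      | exact hab.not_cross hyz.symm
  -- The weights sum to 3, and the two bichromatic edges, counted in both directions, take away at
  -- least 4.
  have h1 := excess_nonneg hG h hmf
  have h2 := excess_insert_le_of_two (S := {x, z}) (x := y) (by simp [hxy.ne.symm, hyz.ne]) hxz
    (by simp) (by simp) hxy.symm hyz
  have h3 := excess_insert (G := G) (σ := σ) (S := {z}) (x := x) (by simpa using hxz)
  have h4 := pairs_nonneg (r := Cross G σ) (S := {x}) (T := {z})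
  rw [excess_singleton, weight_of_covered hx, weight_of_covered hz] at h3
  rw [weight_of_covered hy] at h2
  omega

end Decidable

end SubcubicPacking

namespace SubcubicPacking

variable {V : Type*} {G : SimpleGraph V} {σ : V → Bool} {x y z : V} {S T Y : Finset V}

/-! ### Admissible selections of ends of monochromatic edges -/

/-- All covered vertices of `S` are selected in `Y`. -/
def InDom (G : SimpleGraph V) (σ : V → Bool) (Y S : Finset V) : Prop :=
  ∀ x ∈ S, Covered G σ x → x ∈ Y

/-- `Y` selects at most one end of each monochromatic edge, and a set of selected and uncovered
vertices that has no excess contains two adjacent selected vertices (or no selected vertex). -/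
structure Admissible (G : SimpleGraph V) (σ : V → Bool) (Y : Finset V) : Prop where
  covered : ∀ x ∈ Y, Covered G σ x
  mateFree : MateFree G σ Y
  exists_cross : ∀ S, InDom G σ Y S → excess G σ S ≤ 0 → (∃ x ∈ S, Covered G σ x) →
    ∃ p ∈ S, ∃ q ∈ S, p ∈ Y ∧ q ∈ Y ∧ Cross G σ p q

/-- The mate of the selected vertex `x` has a selected neighbour that is not a neighbour of `x`. -/
def Source (G : SimpleGraph V) (σ : V → Bool) (Y : Finset V) (x : V) : Prop :=
  x ∈ Y ∧ ∃ x' y, Mono G σ x x' ∧ y ∈ Y ∧ Cross G σ x' y ∧ ¬ Cross G σ x y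

lemma InDom.mateFree (hY : MateFree G σ Y) (hS : InDom G σ Y S) : MateFree G σ S :=
  fun x hx y hy h => hY x (hS x hx h.covered) y (hS y hy h.covered_right) h

lemma InDom.subset (hT : InDom G σ Y T) (h : S ⊆ T) : InDom G σ Y S := fun x hx => hT x (h hx)

lemma InDom.mono {Y' : Finset V} (h : InDom G σ Y S) (hY : Y ⊆ Y') : InDom G σ Y' S :=
  fun x hx hc => hY (h x hx hc)

section Decidable

variable [DecidableEq V]

lemma InDom.union (hS : InDom G σ Y S) (hT : InDom G σ Y T) : InDom G σ Y (S ∪ T) := by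
  intro x hx hc
  rcases Finset.mem_union.1 hx with h | h
  · exact hS x h hc
  · exact hT x h hc

lemma InDom.insert_uncovered (hS : InDom G σ Y S) (hx : ¬ Covered G σ x) :
    InDom G σ Y (insert x S) := by
  intro y hy hc
  rcases Finset.mem_insert.1 hy with rfl | h
  · exact absurd hc hx
  · exact hS y h hc

lemma InDom.of_insert (hS : InDom G σ (insert x Y) S) (hx : x ∉ S) : InDom G σ Y S := by
  intro y hy hc
  rcases Finset.mem_insert.1 (hS y hy hc) with rfl | h
  · exact absurd hy hx
  · exact h

variable [Fintype V]

lemma mateFree_insert (hS : MateFree G σ S) (hx : ∀ y ∈ S, ¬ Mono G σ x y) :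
    MateFree G σ (insert x S) := by
  intro a ha b hb hab
  rcases Finset.mem_insert.1 ha with rfl | ha' <;> rcases Finset.mem_insert.1 hb with rfl | hb'
  · exact hab.ne rfl
  · exact hx b hb' hab
  · exact hx a ha' hab.symm
  · exact hS a ha' b hb' hab

/-- Uncrossing two sets without excess. -/
lemma uncross (hG : G.IsSubcubic) (hσ : IsMaxCut G σ) (hY : MateFree G σ Y)
    (hS : InDom G σ Y S) (hT : InDom G σ Y T) (hS0 : excess G σ S ≤ 0) (hT0 : excess G σ T ≤ 0) :
    excess G σ (S ∪ T) ≤ 0 ∧ excess G σ (S ∩ T) ≤ 0 ∧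
      ∀ x ∈ S \ T, ∀ y ∈ T \ S, ¬ Cross G σ x y := by
  have h1 := excess_nonneg hG hσ ((hS.union hT).mateFree hY)
  have h2 := excess_nonneg hG hσ ((hS.subset (S := S ∩ T) Finset.inter_subset_left).mateFree hY)
  have h3 := excess_union_add_excess_inter (G := G) (σ := σ) (S := S) (T := T)
  have h4 := pairs_nonneg (r := Cross G σ) (S := S \ T) (T := T \ S)
  refine ⟨by omega, by omega, forall_not_of_pairs_eq_zero (by omega)⟩

/-- A covered vertex next to a set without excess belongs to it or has its mate in it. -/
lemma exists_mate_of_cross (hG : G.IsSubcubic) (hσ : IsMaxCut G σ) (hS : MateFree G σ S)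
    (hS0 : excess G σ S ≤ 0) (hx : Covered G σ x) (hxS : x ∉ S) (hy : y ∈ S)
    (hxy : Cross G σ x y) : ∃ z ∈ S, Mono G σ x z := by
  by_contra! h
  have hmf : MateFree G σ (insert x S) := mateFree_insert hS h
  have h1 := excess_nonneg hG hσ hmf
  have h2 := excess_insert_le hxS hy hxy
  rw [weight_of_covered hx] at h2
  omega

/-- A mate of `x` in `S` would be covered, hence selected along with `x`; so the other outcome of
`exists_mate_of_cross` is impossible. -/
lemma mem_of_cross (hG : G.IsSubcubic) (hσ : IsMaxCut G σ) (hY : MateFree G σ Y)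
    (hS : InDom G σ Y S) (hS0 : excess G σ S ≤ 0) (hxY : x ∈ Y) (hx : Covered G σ x) (hy : y ∈ S)
    (hxy : Cross G σ x y) : x ∈ S := by
  by_contra hxS
  obtain ⟨z, hz, hxz⟩ := exists_mate_of_cross hG hσ (hS.mateFree hY) hS0 hx hxS hy hxy
  exact hY x hxY z (hS z hz hxz.covered_right) hxz

/-- No monochromatic edge touches `S`, so its margin, which is at most its excess, counts all
bichromatic edges leaving it. Such a set can be split off. -/
lemma pairs_cross_compl_eq_zero (hG : G.IsSubcubic) (hσ : IsMaxCut G σ)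
    (hS : ∀ x ∈ S, ¬ Covered G σ x) (hS0 : excess G σ S ≤ 0) : pairs (Cross G σ) S Sᶜ = 0 := by
  have h1 := margin_le_excess hG hσ (S := S) fun x hx y _ h => hS x hx h.covered
  have h2 : pairs (Mono G σ) S Sᶜ = 0 := pairs_eq_zero fun x hx y _ h => hS x hx h.covered
  have h3 := pairs_nonneg (r := Cross G σ) (S := S) (T := Sᶜ)
  rw [margin] at h1
  omega

/-! ### Toggling selected vertices -/

lemma mateFree_toggle (hG : G.IsSubcubic) (hσ : IsMaxCut G σ) (hY : MateFree G σ Y) {x' : V}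
    (hm : Mono G σ x x') : MateFree G σ (insert x' (Y.erase x)) := by
  intro a ha b hb hab
  rcases Finset.mem_insert.1 ha with rfl | ha' <;> rcases Finset.mem_insert.1 hb with rfl | hb'
  · exact hab.ne rfl
  · exact (Finset.mem_erase.1 hb').1 (mono_unique hG hσ hab hm.symm)
  · exact (Finset.mem_erase.1 ha').1 (mono_unique hG hσ hab.symm hm.symm)
  · exact hY a (Finset.mem_of_mem_erase ha') b (Finset.mem_of_mem_erase hb') hab

/-- A set without excess that contains `x'` is forced by `mem_of_cross` to contain the selected
neighbour `y`, which supplies the required edge. A set avoiding `x'` is covered by the old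
selection. -/
lemma Admissible.toggle (hG : G.IsSubcubic) (hσ : IsMaxCut G σ) (hY : Admissible G σ Y) {x' : V}
    (hm : Mono G σ x x') (hy : y ∈ Y) (hxy : y ≠ x) (hc : Cross G σ x' y) :
    Admissible G σ (insert x' (Y.erase x)) := by
  have hmf := mateFree_toggle hG hσ hY.mateFree hm
  refine ⟨?_, hmf, ?_⟩
  · intro a ha
    rcases Finset.mem_insert.1 ha with rfl | ha
    · exact hm.covered_right
    · exact hY.covered a (Finset.mem_of_mem_erase ha)
  · intro S hS hS0 hSc
    by_cases hx' : x' ∈ S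
    · have hyY : y ∈ insert x' (Y.erase x) := by simp [hy, hxy]
      exact ⟨x', hx', y, mem_of_cross hG hσ hmf hS hS0 hyY (hY.covered y hy) hx' hc.symm,
        by simp, hyY, hc⟩
    · have hS' := hS.of_insert hx'
      obtain ⟨p, hp, q, hq, hpY, hqY, hpq⟩ :=
        hY.exists_cross S (hS'.mono (Finset.erase_subset _ _)) hS0 hSc
      exact ⟨p, hp, q, hq, hS p hp (hY.covered p hpY), hS q hq (hY.covered q hqY), hpq⟩

lemma card_toggle {x' : V} (hx : x ∈ Y) (hx' : x' ∉ Y) :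
    (insert x' (Y.erase x)).card = Y.card := by
  rw [Finset.card_insert_of_notMem (by simp [hx']), Finset.card_erase_add_one hx]

/-- A vertex without selected neighbours can be made a non-source. -/
lemma Admissible.exists_not_source (hG : G.IsSubcubic) (hσ : IsMaxCut G σ)
    (hY : Admissible G σ Y) (hnp : ∀ t ∈ Y, ¬ Cross G σ x t) :
    ∃ Z, Admissible G σ Z ∧ Z.card = Y.card ∧ Y.erase x ⊆ Z ∧ (∀ u ∈ Z, u ∈ Y ∨ Mono G σ x u) ∧
      ∀ u, Source G σ Z u → Source G σ Y u ∧ u ≠ x := by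
  by_cases hs : Source G σ Y x
  · obtain ⟨hx, x', y, hm, hy, hc, hnc⟩ := hs
    have hx'Y : x' ∉ Y := fun h => hY.mateFree x hx x' h hm
    have hyx : y ≠ x := by rintro rfl; exact hm.symm.not_cross hc
    refine ⟨insert x' (Y.erase x), hY.toggle hG hσ hm hy hyx hc, card_toggle hx hx'Y,
      Finset.subset_insert _ _, ?_, ?_⟩
    · intro u hu
      rcases Finset.mem_insert.1 hu with rfl | hu
      · exact .inr hm
      · exact .inl (Finset.mem_of_mem_erase hu)
    · rintro u ⟨hu, u', s, hmu, hs, hus, hnus⟩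
      have hs' : s = x' ∨ s ∈ Y :=
        (Finset.mem_insert.1 hs).imp_right Finset.mem_of_mem_erase
      rcases Finset.mem_insert.1 hu with rfl | hu
      · obtain rfl := mono_unique hG hσ hmu hm.symm
        rcases hs' with rfl | hs'
        · exact absurd hus hm.not_cross
        · exact absurd hus (hnp s hs')
      · obtain ⟨hux, huY⟩ := Finset.mem_erase.1 hu
        rcases hs' with rfl | hs'
        -- The new vertex would be adjacent to `u'` and to `y`, all covered, so `u'` and `y` are
        -- mates and `u` is `y`. But then `u` is itself adjacent to the new vertex, which a source
        -- may not be.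
        · exfalso
          by_cases hu'y : u' = y
          · subst hu'y
            exact hY.mateFree u huY u' hy hmu
          · have := mono_of_cross_of_cross hG hσ hmu.covered_right hm.covered_right
              (hY.covered y hy) hus hc hu'y
            obtain rfl := mono_unique hG hσ hmu.symm this
            exact hnus hc.symm
        · exact ⟨⟨huY, u', s, hmu, hs', hus, hnus⟩, hux⟩
  · refine ⟨Y, hY, rfl, Finset.erase_subset _ _, fun u hu => .inl hu, fun u hu => ⟨hu, ?_⟩⟩
    rintro rfl
    exact hs hu

/-- Two adjacent sources can be toggled to be non-sources. -/
lemma Admissible.exists_not_source_of_cross (hG : G.IsSubcubic) (hσ : IsMaxCut G σ)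
    (hY : Admissible G σ Y) {x₁ x₂ : V} (h₁ : Source G σ Y x₁) (h₂ : Source G σ Y x₂)
    (h₁₂ : Cross G σ x₁ x₂) :
    ∃ Z, Admissible G σ Z ∧ Z.card = Y.card ∧
      ∀ u, Source G σ Z u → Source G σ Y u ∧ u ≠ x₁ ∧ u ≠ x₂ := by
  obtain ⟨hx₁, x₁', y₁, hm₁, hy₁, hc₁, hn₁⟩ := h₁
  obtain ⟨hx₂, x₂', y₂, hm₂, hy₂, hc₂, hn₂⟩ := h₂
  have hx₁' : x₁' ∉ Y := fun h => hY.mateFree _ hx₁ _ h hm₁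
  have hx₂' : x₂' ∉ Y := fun h => hY.mateFree _ hx₂ _ h hm₂
  have hy₁x₁ : y₁ ≠ x₁ := by rintro rfl; exact hm₁.symm.not_cross hc₁
  have hy₁x₂ : y₁ ≠ x₂ := by rintro rfl; exact hn₁ h₁₂
  have hy₂x₁ : y₂ ≠ x₁ := by rintro rfl; exact hn₂ h₁₂.symm
  have hy₂x₂ : y₂ ≠ x₂ := by rintro rfl; exact hm₂.symm.not_cross hc₂
  have hne : x₁' ≠ x₂' := by
    rintro rfl
    exact h₁₂.ne (mono_unique hG hσ hm₁.symm hm₂.symm)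
  have hx₁'x₂ : x₁' ≠ x₂ := by rintro rfl; exact hx₁' hx₂
  have ha := hY.toggle hG hσ hm₁ hy₁ hy₁x₁ hc₁
  have hb := ha.toggle hG hσ hm₂ (y := y₂) (by simp [hy₂, hy₂x₁]) hy₂x₂ hc₂
  refine ⟨_, hb, ?_, ?_⟩
  · rw [card_toggle (by simp [hx₂, h₁₂.ne.symm]) (by simp [hx₂', hne.symm]), card_toggle hx₁ hx₁']
  · rintro u ⟨hu, u', s, hmu, hs, hus, hnus⟩
    have mem : ∀ {a}, a ∈ insert x₂' ((insert x₁' (Y.erase x₁)).erase x₂) →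
        a = x₂' ∨ a = x₁' ∨ (a ∈ Y ∧ a ≠ x₁ ∧ a ≠ x₂) := by
      intro a; simp only [Finset.mem_insert, Finset.mem_erase]; tauto
    -- In `key` and `key2` the forbidden edge completes a bichromatic path of three covered
    -- vertices; its ends would be mates although both are selected.
    have key : ∀ {a b a' b' c : V}, a ∈ Y → b ∈ Y → Mono G σ a a' → Mono G σ b b' → c ∈ Y →
        Cross G σ b' c → a ≠ c → ¬ Cross G σ a b' := by
      intro a b a' b' c ha hb hma hmb hc hbc hac hab
      exact hY.mateFree a ha c hc (mono_of_cross_of_cross hG hσ hma.covered hmb.covered_right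
        (hY.covered c hc) hab hbc hac)
    have key2 : ∀ {a b b' c : V}, a ∈ Y → b ∈ Y → Cross G σ a b → Mono G σ b b' → c ∈ Y →
        c ≠ b → ¬ Cross G σ a c := by
      intro a b b' c ha hb hab hmb hc hcb hac
      exact hY.mateFree b hb c hc (mono_of_cross_of_cross hG hσ hmb.covered (hY.covered a ha)
        (hY.covered c hc) hab.symm hac hcb.symm)
    rcases mem hu with rfl | rfl | ⟨huY, hux₁, hux₂⟩
    · obtain rfl := mono_unique hG hσ hmu hm₂.symm
      exfalso
      rcases mem hs with rfl | rfl | ⟨hsY, hsx₁, hsx₂⟩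
      · exact hm₂.not_cross hus
      · exact key hx₂ hx₁ hm₂ hm₁ hy₁ hc₁ hy₁x₂.symm hus
      · exact key2 hx₂ hx₁ h₁₂.symm hm₁ hsY hsx₁ hus
    · obtain rfl := mono_unique hG hσ hmu hm₁.symm
      exfalso
      rcases mem hs with rfl | rfl | ⟨hsY, hsx₁, hsx₂⟩
      · exact key hx₁ hx₂ hm₁ hm₂ hy₂ hc₂ hy₂x₁.symm hus
      · exact hm₁.not_cross hus
      · exact key2 hx₁ hx₂ h₁₂ hm₂ hsY hsx₂ hus
    · refine ⟨⟨huY, u', s, hmu, ?_, hus, hnus⟩, hux₁, hux₂⟩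
      have key3 : ∀ {b b' c : V}, Mono G σ b b' → c ∈ Y → Cross G σ b' c → s ≠ b' := by
        rintro b b' c hmb hc hbc rfl
        by_cases hu'c : u' = c
        · subst hu'c
          exact hY.mateFree u huY u' hc hmu
        · have := mono_of_cross_of_cross hG hσ hmu.covered_right hmb.covered_right
            (hY.covered c hc) hus hbc hu'c
          obtain rfl := mono_unique hG hσ hmu.symm this
          exact hnus hbc.symm
      rcases mem hs with rfl | rfl | ⟨hsY, -, -⟩
      · exact absurd rfl (key3 hm₂ hy₂ hc₂)
      · exact absurd rfl (key3 hm₁ hy₁ hc₁)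
      · exact hsY

/-! ### Optimal selections -/

open Classical in
/-- The set of sources of a selection. -/
noncomputable def sources (G : SimpleGraph V) (σ : V → Bool) (Y : Finset V) : Finset V :=
  Y.filter (Source G σ Y)

lemma mem_sources : x ∈ sources G σ Y ↔ Source G σ Y x := by
  simp only [sources, Finset.mem_filter, and_iff_right_iff_imp]
  exact fun h => h.1

/-- A largest admissible selection, over all maximum cuts, with as few sources as possible. -/
structure Optimal (G : SimpleGraph V) (σ : V → Bool) (Y : Finset V) : Prop where
  isMaxCut : IsMaxCut G σ
  admissible : Admissible G σ Y
  card_le : ∀ τ Z, IsMaxCut G τ → Admissible G τ Z → Z.card ≤ Y.card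
  sources_le : ∀ τ Z, IsMaxCut G τ → Admissible G τ Z → Z.card = Y.card →
    (sources G σ Y).card ≤ (sources G τ Z).card

lemma admissible_empty : Admissible G σ ∅ where
  covered := by simp
  mateFree := by simp [MateFree]
  exists_cross := by
    rintro S hS - ⟨x, hx, hc⟩
    exact absurd (hS x hx hc) (by simp)

variable (G) in
lemma exists_optimal : ∃ σ Y, Optimal G σ Y := by
  classical
  let A : Set ((V → Bool) × Finset V) := {p | IsMaxCut G p.1 ∧ Admissible G p.1 p.2}
  have hA : A.Nonempty := by
    obtain ⟨σ, hσ⟩ := exists_isMaxCut G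
    exact ⟨(σ, ∅), hσ, admissible_empty⟩
  obtain ⟨p, hp, hmax⟩ := A.exists_max_image (fun p => p.2.card) A.toFinite hA
  let B : Set ((V → Bool) × Finset V) := {q | q ∈ A ∧ q.2.card = p.2.card}
  obtain ⟨q, hq, hmin⟩ := B.exists_min_image (fun p => (sources G p.1 p.2).card) B.toFinite
    ⟨p, hp, rfl⟩
  refine ⟨q.1, q.2, hq.1.1, hq.1.2, fun τ Z hτ hZ => ?_, fun τ Z hτ hZ hc => ?_⟩
  · rw [hq.2]
    exact hmax (τ, Z) ⟨hτ, hZ⟩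
  · exact hmin (τ, Z) ⟨⟨hτ, hZ⟩, hc.trans hq.2⟩

/-- Otherwise toggling lowers the number of sources: `x` alone if it has no selected neighbour, and
`x` together with an adjacent source if it has one. -/
lemma Optimal.exists_cross_of_source (hG : G.IsSubcubic) (h : Optimal G σ Y)
    (hx : Source G σ Y x) : ∃ t ∈ Y, Cross G σ x t ∧ ¬ Source G σ Y t := by
  have hlt : ∀ Z, Admissible G σ Z → Z.card = Y.card →
      ¬ ∀ u, Source G σ Z u → Source G σ Y u ∧ u ≠ x := by
    intro Z hZ hc hu
    have h1 := h.sources_le σ Z h.isMaxCut hZ hc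
    have h2 : sources G σ Z ⊆ (sources G σ Y).erase x := by
      intro u hu'
      obtain ⟨h3, h4⟩ := hu u (mem_sources.1 hu')
      exact Finset.mem_erase.2 ⟨h4, mem_sources.2 h3⟩
    have h3 := Finset.card_le_card h2
    have h4 := Finset.card_erase_lt_of_mem (mem_sources.2 hx)
    omega
  by_contra! hn
  by_cases hp : ∀ t ∈ Y, ¬ Cross G σ x t
  · obtain ⟨Z, hZ, hc, -, -, hu⟩ := h.admissible.exists_not_source hG h.isMaxCut hp
    exact hlt Z hZ hc hu
  · push Not at hp
    obtain ⟨t, ht, hxt⟩ := hp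
    obtain ⟨Z, hZ, hc, hu⟩ :=
      h.admissible.exists_not_source_of_cross hG h.isMaxCut hx (hn t ht hxt) hxt
    exact hlt Z hZ hc fun u hu' => ⟨(hu u hu').1, (hu u hu').2.1⟩

/-! ### Blocked vertices -/

/-- `R` is a minimal set without excess that contains `e` and else only vertices of `Y` and
uncovered vertices. -/
structure Blocked (G : SimpleGraph V) (σ : V → Bool) (Y : Finset V) (e : V) (R : Finset V) :
    Prop where
  mem : e ∈ R
  inDom : InDom G σ (insert e Y) R
  excess_le : excess G σ R ≤ 0
  eq_of_subset : ∀ S ⊆ R, S.Nonempty → excess G σ S ≤ 0 → S = R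

/-- The pair has excess at most 1 + 1 - 2 = 0, a single covered vertex has excess 1. This blocks
sources and their mates. -/
lemma blocked_pair {e t : V} (he : Covered G σ e) (ht : Covered G σ t) (htY : t ∈ Y)
    (h : Cross G σ e t) : Blocked G σ Y e {e, t} := by
  refine ⟨by simp, ?_, ?_, ?_⟩
  · intro a ha _
    rcases Finset.mem_insert.1 ha with rfl | ha
    · simp
    · simp_all
  · have := excess_insert_le (S := {t}) (by simpa using h.ne) (by simp) h
    rw [excess_singleton, weight_of_covered he, weight_of_covered ht] at this
    omega
  · intro S hS hne hS0
    have h1 : S ⊂ {e, t} → False := by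
      intro hss
      have hc := Finset.card_lt_card hss
      rw [Finset.card_pair h.ne] at hc
      have h2 := hne.card_pos
      obtain ⟨a, rfl⟩ := Finset.card_eq_one.1 (by omega : S.card = 1)
      rw [excess_singleton] at hS0
      have : a = e ∨ a = t := by simpa using hS
      rcases this with rfl | rfl
      · rw [weight_of_covered he] at hS0; omega
      · rw [weight_of_covered ht] at hS0; omega
    by_contra hne'
    exact h1 (hS.ssubset_of_ne hne')

/-- Inside a set that violates admissibility of `insert e Y`, take a smallest set without excess
containing `e`. A nonempty part without excess that avoids `e` has only uncovered vertices, by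
admissibility of `Y`, so no bichromatic edge leaves it and removing it would give a smaller set. -/
lemma Admissible.exists_blocked (hG : G.IsSubcubic) (hσ : IsMaxCut G σ) (hY : Admissible G σ Y)
    {e e' : V} (he : Mono G σ e e') (he' : e' ∉ Y)
    (hn : ¬ Admissible G σ (insert e Y)) :
    ∃ R, Blocked G σ Y e R ∧ ∀ p ∈ R, ∀ q ∈ R, Covered G σ p → Covered G σ q → ¬ Cross G σ p q := by
  classical
  have hmf : MateFree G σ (insert e Y) :=
    mateFree_insert hY.mateFree fun y hy hey => he' (mono_unique hG hσ he hey ▸ hy)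
  have hcov : ∀ x ∈ insert e Y, Covered G σ x := by
    intro x hx
    rcases Finset.mem_insert.1 hx with rfl | hx
    · exact he.covered
    · exact hY.covered x hx
  obtain ⟨S, hS, hS0, hSc, hSp⟩ : ∃ S, InDom G σ (insert e Y) S ∧ excess G σ S ≤ 0 ∧
      (∃ x ∈ S, Covered G σ x) ∧
        ∀ p ∈ S, ∀ q ∈ S, Covered G σ p → Covered G σ q → ¬ Cross G σ p q := by
    by_contra! h
    refine hn ⟨hcov, hmf, fun S hS hS0 hSc => ?_⟩
    obtain ⟨p, hp, q, hq, hpc, hqc, hpq⟩ := h S hS hS0 hSc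
    exact ⟨p, hp, q, hq, hS p hp hpc, hS q hq hqc, hpq⟩
  have hfree : ∀ T ⊆ S, e ∉ T → excess G σ T ≤ 0 → ∀ x ∈ T, ¬ Covered G σ x := by
    intro T hTS heT hT0 x hx hc
    obtain ⟨p, hp, q, hq, hpY, hqY, hpq⟩ :=
      hY.exists_cross T ((hS.subset hTS).of_insert heT) hT0 ⟨x, hx, hc⟩
    exact hSp p (hTS hp) q (hTS hq) (hY.covered p hpY) (hY.covered q hqY) hpq
  have heS : e ∈ S := by
    by_contra heS
    obtain ⟨x, hx, hc⟩ := hSc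
    exact hfree S subset_rfl heS hS0 x hx hc
  obtain ⟨R, hR, hmin⟩ := Finset.exists_min_image
    (S.powerset.filter fun R => e ∈ R ∧ excess G σ R ≤ 0) Finset.card
    ⟨S, by simp [heS, hS0]⟩
  simp only [Finset.mem_filter, Finset.mem_powerset] at hR hmin
  obtain ⟨hRS, heR, hR0⟩ := hR
  refine ⟨R, ⟨heR, hS.subset hRS, hR0, ?_⟩, fun p hp q hq => hSp p (hRS hp) q (hRS hq)⟩
  intro T hTR hTne hT0
  by_cases heT : e ∈ T
  · exact Finset.eq_of_subset_of_card_le hTR (hmin T ⟨hTR.trans hRS, heT, hT0⟩)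
  · exfalso
    have hTc := hfree T (hTR.trans hRS) heT hT0
    have h1 := pairs_cross_compl_eq_zero hG hσ hTc hT0
    have h2 : pairs (Cross G σ) T (R \ T) = 0 :=
      pairs_eq_zero fun a ha b hb => forall_not_of_pairs_eq_zero h1 a ha b (by
        simp only [Finset.mem_sdiff] at hb
        simpa using hb.2)
    have h3 := excess_disjUnion (G := G) (σ := σ) (S := T) (T := R \ T) Finset.disjoint_sdiff
    rw [Finset.union_sdiff_of_subset hTR, h2] at h3
    have h4 := excess_nonneg hG hσ (S := T) fun x hx y _ h => hTc x hx h.covered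
    have h5 := hmin (R \ T) ⟨Finset.sdiff_subset.trans hRS, by simp [heR, heT], by omega⟩
    have h6 := Finset.card_lt_card (Finset.sdiff_ssubset hTR hTne)
    omega

end Decidable

end SubcubicPacking

namespace SubcubicPacking

variable {V : Type*} {G : SimpleGraph V} {σ : V → Bool} {x y z e f v w : V}
  {S T Y R R' : Finset V} [DecidableEq V] [Fintype V]

lemma exists_of_pairs_pos {r : V → V → Prop} (h : 0 < pairs r S T) : ∃ x ∈ S, ∃ y ∈ T, r x y := by
  by_contra! hn
  rw [pairs_eq_zero hn] at h
  exact lt_irrefl _ h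

lemma Blocked.mono {Y' : Finset V} (h : Blocked G σ Y e R) (hY : Y ⊆ Y') : Blocked G σ Y' e R :=
  ⟨h.mem, h.inDom.mono (Finset.insert_subset_insert _ hY), h.excess_le, h.eq_of_subset⟩

/-! ### Distances between blocked vertices -/

section Far

variable (hG : G.IsSubcubic) (hσ : IsMaxCut G σ) (hmf : MateFree G σ (insert e (insert f Y)))
  (hR : Blocked G σ Y e R) (hR' : Blocked G σ Y f R')

include hG hσ hmf hR hR'

lemma Blocked.inDom_left : InDom G σ (insert e (insert f Y)) R :=
  hR.inDom.mono (Finset.insert_subset_insert _ (Finset.subset_insert _ _))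

lemma Blocked.inDom_right : InDom G σ (insert e (insert f Y)) R' :=
  hR'.inDom.mono (Finset.subset_insert _ _)

/-- By uncrossing, a nonempty intersection has no excess, so by minimality it is all of `R`; but
`R'` may not contain `e`. -/
lemma Blocked.disjoint (he : Covered G σ e) (heY : e ∉ Y) (hef : e ≠ f) : Disjoint R R' := by
  rw [Finset.disjoint_iff_inter_eq_empty]
  by_contra hne
  have h1 := (uncross hG hσ hmf (Blocked.inDom_left hG hσ hmf hR hR')
    (Blocked.inDom_right hG hσ hmf hR hR') hR.excess_le hR'.excess_le).2.1
  have h2 := hR.eq_of_subset _ Finset.inter_subset_left (Finset.nonempty_iff_ne_empty.2 hne) h1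
  have h3 : e ∈ R ∩ R' := by rw [h2]; exact hR.mem
  have h4 := hR'.inDom e (Finset.mem_inter.1 h3).2 he
  simp [hef, heY] at h4

lemma Blocked.not_cross (hd : Disjoint R R') (hx : x ∈ R) (hy : y ∈ R') : ¬ Cross G σ x y := by
  refine (uncross hG hσ hmf (Blocked.inDom_left hG hσ hmf hR hR')
    (Blocked.inDom_right hG hσ hmf hR hR') hR.excess_le hR'.excess_le).2.2 x ?_ y ?_
  · exact Finset.mem_sdiff.2 ⟨hx, Finset.disjoint_left.1 hd hx⟩
  · exact Finset.mem_sdiff.2 ⟨hy, Finset.disjoint_right.1 hd hy⟩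

/-- If `v` is covered, its mate lies in both sets. If not, adding `v` to the union changes the
excess by at most 3 - 4. -/
lemma Blocked.not_common (hd : Disjoint R R') (hx : x ∈ R) (hy : y ∈ R') (hvx : Cross G σ v x)
    (hvy : Cross G σ v y) : False := by
  have hnc := fun {x y} => Blocked.not_cross (x := x) (y := y) hG hσ hmf hR hR' hd
  have hvR : v ∉ R := fun h => hnc h hy hvy
  have hvR' : v ∉ R' := fun h => hnc hx h hvx.symm
  have hdR := Blocked.inDom_left hG hσ hmf hR hR'
  have hdR' := Blocked.inDom_right hG hσ hmf hR hR'
  by_cases hv : Covered G σ v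
  · obtain ⟨z, hz, hvz⟩ := exists_mate_of_cross hG hσ (hdR.mateFree hmf) hR.excess_le hv hvR hx hvx
    obtain ⟨z', hz', hvz'⟩ :=
      exists_mate_of_cross hG hσ (hdR'.mateFree hmf) hR'.excess_le hv hvR' hy hvy
    obtain rfl := mono_unique hG hσ hvz hvz'
    exact Finset.disjoint_left.1 hd hz hz'
  · have h1 := excess_nonneg hG hσ (((hdR.union hdR').insert_uncovered hv).mateFree hmf)
    have h2 := (uncross hG hσ hmf hdR hdR' hR.excess_le hR'.excess_le).1
    have h3 := excess_insert_le_of_two (S := R ∪ R') (by simp [hvR, hvR'])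
      (by rintro rfl; exact Finset.disjoint_left.1 hd hx hy) (Finset.mem_union_left _ hx)
      (Finset.mem_union_right _ hy) hvx hvy
    rw [weight_of_not_covered hv] at h3
    omega

/-- On a bichromatic path of length three between two blocked vertices, the first inner vertex is
not covered. -/
lemma Blocked.not_covered (hd : Disjoint R R') (he : Covered G σ e) (hev : Cross G σ e v)
    (hvw : Cross G σ v w) (hwf : Cross G σ w f) : ¬ Covered G σ v := by
  intro hv
  have hnc := fun {x y} => Blocked.not_cross (x := x) (y := y) hG hσ hmf hR hR' hd
  have hncom := fun {x y v} => Blocked.not_common (x := x) (y := y) (v := v) hG hσ hmf hR hR' hd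
  have hdR := Blocked.inDom_left hG hσ hmf hR hR'
  have hdR' := Blocked.inDom_right hG hσ hmf hR hR'
  have hvR : v ∉ R := fun h => hncom h hR'.mem hvw.symm hwf
  have hvR' : v ∉ R' := fun h => hnc hR.mem h hev
  have hwR : w ∉ R := fun h => hnc h hR'.mem hwf
  have hwR' : w ∉ R' := fun h => hncom hR.mem h hev.symm hvw
  have heR' : e ∉ R' := Finset.disjoint_left.1 hd hR.mem
  obtain ⟨z, hz, hvz⟩ :=
    exists_mate_of_cross hG hσ (hdR.mateFree hmf) hR.excess_le hv hvR hR.mem hev.symm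
  by_cases hw : Covered G σ w
  · have h1 := mono_of_cross_of_cross hG hσ he hv hw hev hvw
      (fun h => hwR (h ▸ hR.mem))
    obtain ⟨z', hz', hwz'⟩ :=
      exists_mate_of_cross hG hσ (hdR'.mateFree hmf) hR'.excess_le hw hwR' hR'.mem hwf
    exact heR' (mono_unique hG hσ h1.symm hwz' ▸ hz')
  · have hmf1 : MateFree G σ (insert w R') :=
      mateFree_insert (hdR'.mateFree hmf) fun y _ h => hw h.covered
    have hmf2 : MateFree G σ (insert v (insert w R')) := by
      refine mateFree_insert hmf1 fun y hy hvy => ?_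
      obtain rfl := mono_unique hG hσ hvy hvz
      rcases Finset.mem_insert.1 hy with rfl | hy
      · exact hwR hz
      · exact Finset.disjoint_left.1 hd hz hy
    -- Adding `w` to `R'` contributes at most 3 - 2 and then `v` at most 1 - 2, so the enlarged set
    -- still has no excess and must contain the mate of `e`, the neighbour of `v`.
    have h1 := excess_insert_le (S := R') hwR' hR'.mem hwf
    have h2 := excess_insert_le (S := insert w R') (x := v) (by simp [hvw.ne, hvR']) (by simp) hvw
    rw [weight_of_not_covered hw] at h1
    rw [weight_of_covered hv] at h2
    have h3 := hR'.excess_le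
    have hew : e ≠ w := by rintro rfl; exact hwR hR.mem
    obtain ⟨z', hz', hez'⟩ := exists_mate_of_cross hG hσ hmf2 (by omega) he (x := e)
      (by simp [hev.ne, heR', hew]) (Finset.mem_insert_self _ _) hev
    rcases Finset.mem_insert.1 hz' with rfl | hz'
    · exact hez'.not_cross hev
    rcases Finset.mem_insert.1 hz' with rfl | hz'
    · exact hw hez'.covered_right
    · exact hmf e (by simp) z' (hdR' z' hz' hez'.covered_right) hez'

end Far

/-! ### Switching along sets without excess -/

section Switch

variable (hG : G.IsSubcubic) (hσ : IsMaxCut G σ)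

include hG hσ

lemma margin_eq_zero (hT : MateFree G σ T) (hT0 : excess G σ T ≤ 0) :
    margin G σ T = 0 ∧ ∀ x ∈ T, pairs G.Adj {x} .univ = 3 := by
  have h1 := excess_eq hG hσ hT
  have h2 := hσ.margin_nonneg T
  have h3 : ∀ x ∈ T, 0 ≤ 3 - pairs G.Adj {x} .univ := fun x _ => by
    linarith [pairs_adj_le_three hG x .univ]
  have h4 := Finset.sum_nonneg h3
  refine ⟨by omega, fun x hx => ?_⟩
  have h5 := (Finset.sum_eq_zero_iff_of_nonneg h3).1 (by omega) x hx
  omega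

lemma mateFree_switch (hT : MateFree G σ T) : MateFree G (switch σ T) T :=
  fun x hx y hy h => hT x hx y hy ((mono_switch_of_mem hx hy).1 h)

lemma isMaxCut_switch (hT : MateFree G σ T) (hT0 : excess G σ T ≤ 0) :
    IsMaxCut G (switch σ T) :=
  hσ.switch (margin_eq_zero hG hσ hT hT0).1

/-- Complementation in `T` preserves the absence of excess when switching along `T`. -/
lemma excess_sdiff_le (hT : MateFree G σ T) (hT0 : excess G σ T ≤ 0) (hS : S ⊆ T)
    (hS0 : excess G (switch σ T) S ≤ 0) : excess G σ (T \ S) ≤ 0 := by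
  obtain ⟨hm, hdeg⟩ := margin_eq_zero hG hσ hT hT0
  have hzero : ∀ U ⊆ T, ∑ x ∈ U, (3 - pairs G.Adj {x} .univ) = 0 := fun U hU =>
    Finset.sum_eq_zero fun x hx => by rw [hdeg x (hU hx)]; simp
  have h1 := excess_eq hG (isMaxCut_switch hG hσ hT hT0)
    ((mateFree_switch hG hσ hT).subset hS)
  have h2 := excess_eq hG hσ (hT.subset (Finset.sdiff_subset (s := T) (t := S)))
  rw [hzero _ hS] at h1
  rw [hzero _ Finset.sdiff_subset] at h2
  have c1 : Sᶜ = (T \ S) ∪ Tᶜ := by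
    ext a
    have := @hS a
    simp only [Finset.mem_compl, Finset.mem_union, Finset.mem_sdiff]
    tauto
  have c2 : (T \ S)ᶜ = S ∪ Tᶜ := by
    ext a
    have := @hS a
    simp only [Finset.mem_compl, Finset.mem_union, Finset.mem_sdiff]
    tauto
  have d1 : Disjoint (T \ S) Tᶜ := disjoint_compl_right.mono_left Finset.sdiff_subset
  have d2 : Disjoint S Tᶜ := disjoint_compl_right.mono_left hS
  have hTS : T = S ∪ (T \ S) := (Finset.union_sdiff_of_subset hS).symm
  have hnm : ∀ A ⊆ T, ∀ B ⊆ T, pairs (Mono G σ) A B = 0 := fun A hA B hB =>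
    pairs_eq_zero fun x hx y hy => hT x (hA hx) y (hB hy)
  have hSm : ∀ {x}, x ∈ Tᶜ → x ∉ T := fun h => by simpa using h
  have e1 : pairs (Cross G (switch σ T)) S (T \ S) = pairs (Cross G σ) S (T \ S) :=
    pairs_congr fun x hx y hy => cross_switch_of_mem (hS hx) (Finset.sdiff_subset hy)
  have e2 : pairs (Cross G (switch σ T)) S Tᶜ = pairs (Mono G σ) S Tᶜ :=
    pairs_congr fun x hx y hy => cross_switch_left (hS hx) (hSm hy)
  have e3 : pairs (Mono G (switch σ T)) S (T \ S) = pairs (Mono G σ) S (T \ S) :=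
    pairs_congr fun x hx y hy => mono_switch_of_mem (hS hx) (Finset.sdiff_subset hy)
  have e4 : pairs (Mono G (switch σ T)) S Tᶜ = pairs (Cross G σ) S Tᶜ :=
    pairs_congr fun x hx y hy => mono_switch_left (hS hx) (hSm hy)
  -- Expressed by edge counts of `σ`, the margin of `S` after the switch and that of `T \ S` before
  -- it differ by the margin of `T`, which is zero.
  rw [margin, c1, pairs_union_right d1, pairs_union_right d1, e1, e2, e3, e4,
    hnm S hS _ Finset.sdiff_subset] at h1
  rw [margin, c2, pairs_union_right d2, pairs_union_right d2,
    hnm _ Finset.sdiff_subset S hS, pairs_cross_comm (S := T \ S) (T := S)] at h2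
  have h3 : pairs (Cross G σ) T Tᶜ = pairs (Cross G σ) S Tᶜ + pairs (Cross G σ) (T \ S) Tᶜ := by
    rw [← pairs_union_left Finset.disjoint_sdiff, ← hTS]
  have h4 : pairs (Mono G σ) T Tᶜ = pairs (Mono G σ) S Tᶜ + pairs (Mono G σ) (T \ S) Tᶜ := by
    rw [← pairs_union_left Finset.disjoint_sdiff, ← hTS]
  rw [margin, h3, h4] at hm
  omega

lemma excess_switch_self (hT : MateFree G σ T) (hT0 : excess G σ T ≤ 0) :
    excess G (switch σ T) T ≤ 0 := by
  obtain ⟨hm, hdeg⟩ := margin_eq_zero hG hσ hT hT0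
  have h1 := excess_eq hG (isMaxCut_switch hG hσ hT hT0) (mateFree_switch hG hσ hT)
  have e1 : pairs (Cross G (switch σ T)) T Tᶜ = pairs (Mono G σ) T Tᶜ :=
    pairs_congr fun x hx y hy => cross_switch_left hx (by simpa using hy)
  have e2 : pairs (Mono G (switch σ T)) T Tᶜ = pairs (Cross G σ) T Tᶜ :=
    pairs_congr fun x hx y hy => mono_switch_left hx (by simpa using hy)
  rw [Finset.sum_eq_zero fun x hx => by rw [hdeg x hx]; simp, margin, e1, e2] at h1
  rw [margin] at hm
  omega

open Classical in
lemma pairs_mono_univ : pairs (Mono G σ) S .univ = ((S.filter (Covered G σ)).card : ℤ) := by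
  rw [pairs_eq_sum, ← Finset.sum_boole]
  refine Finset.sum_congr rfl fun x _ => ?_
  have := weight_eq hG hσ x
  split_ifs with h
  · rw [weight_of_covered h] at this; omega
  · rw [weight_of_not_covered h] at this; omega

-- Since `T` is mate-free, its covered vertices correspond to the monochromatic edges leaving it.
-- Switching exchanges these with the bichromatic edges leaving `T`, and zero margin says there are
-- equally many.
open Classical in
lemma card_covered_switch (hT : MateFree G σ T) (hT0 : excess G σ T ≤ 0) :
    (T.filter (Covered G (switch σ T))).card = (T.filter (Covered G σ)).card := by
  obtain ⟨hm, -⟩ := margin_eq_zero hG hσ hT hT0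
  have h1 := pairs_mono_univ hG (isMaxCut_switch hG hσ hT hT0) (S := T)
  have h2 := pairs_mono_univ hG hσ (S := T)
  rw [pairs_univ_right T T, pairs_eq_zero (mateFree_switch hG hσ hT),
    pairs_congr (s := Cross G σ) (S := T) (T := Tᶜ) fun x hx y hy =>
      mono_switch_left hx (by simpa using hy)] at h1
  rw [pairs_univ_right T T, pairs_eq_zero hT] at h2
  rw [margin] at hm
  omega

/-- With k neighbours of `x` in `T`, the excess of `T` is at most 1 + 3 - 2k, so k ≤ 2. One of the
three bichromatic edges at `x` therefore leaves `T` and becomes monochromatic. -/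
lemma covered_switch_of_erase (hT : MateFree G σ T) (hT0 : excess G σ T ≤ 0) (hx : x ∈ T)
    (hxc : ¬ Covered G σ x) (hx1 : excess G σ (T.erase x) ≤ 1) : Covered G (switch σ T) x := by
  obtain ⟨-, hdeg⟩ := margin_eq_zero hG hσ hT hT0
  have h1 := excess_insert (G := G) (σ := σ) (Finset.notMem_erase x T)
  rw [Finset.insert_erase hx, weight_of_not_covered hxc] at h1
  have h2 := hdeg x hx
  have h3 := excess_nonneg hG hσ hT
  rw [pairs_adj G σ, pairs_eq_zero (r := Mono G σ), pairs_univ_right {x} (T.erase x)] at h2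
  · obtain ⟨a, ha, y, hy, hxy⟩ := exists_of_pairs_pos (r := Cross G σ) (S := {x})
      (T := (T.erase x)ᶜ) (by omega)
    obtain rfl := Finset.mem_singleton.1 ha
    have hyT : y ∉ T := by
      simp only [Finset.mem_compl, Finset.mem_erase, not_and] at hy
      exact hy hxy.ne.symm
    exact ⟨y, (mono_switch_left hx hyT).2 hxy⟩
  · intro a ha b _ hab
    obtain rfl := Finset.mem_singleton.1 ha
    exact hxc hab.covered

end Switch

/-! ### Selections after a switch -/

open Classical in
/-- The selection that agrees with `Y` outside `T` and selects everything possible in `T` after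
switching along `T`. -/
noncomputable def reselect (G : SimpleGraph V) (σ : V → Bool) (Y T : Finset V) : Finset V :=
  (Y \ T) ∪ T.filter (Covered G (switch σ T))

lemma mem_reselect : x ∈ reselect G σ Y T ↔ (x ∈ Y ∧ x ∉ T) ∨ (x ∈ T ∧ Covered G (switch σ T) x) := by
  simp [reselect]

section Reselect

variable (hG : G.IsSubcubic) (hσ : IsMaxCut G σ) {Y' : Finset V} (hYY' : Y ⊆ Y')
  (hYc : ∀ x ∈ Y, Covered G σ x)
  (hY' : MateFree G σ Y') (hT : InDom G σ Y' T) (hT0 : excess G σ T ≤ 0)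

include hG hσ hYY' hYc hY' hT hT0

lemma mem_of_cross_of_mem (hx : x ∈ T) (hy : y ∈ Y) (hxy : Cross G σ x y) : y ∈ T :=
  mem_of_cross hG hσ hY' hT hT0 (hYY' hy) (hYc y hy) hx hxy.symm

lemma mateFree_reselect : MateFree G (switch σ T) (reselect G σ Y T) := by
  have key : ∀ x ∈ T, ∀ y ∈ Y, y ∉ T → ¬ Cross G σ x y := fun x hx y hy hyT hxy =>
    hyT (mem_of_cross_of_mem hG hσ hYY' hYc hY' hT hT0 hx hy hxy)
  intro x hx y hy hxy
  rcases mem_reselect.1 hx with ⟨hxY, hxT⟩ | ⟨hxT, -⟩ <;>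
    rcases mem_reselect.1 hy with ⟨hyY, hyT⟩ | ⟨hyT, -⟩
  · exact hY' x (hYY' hxY) y (hYY' hyY) ((mono_switch_of_notMem hxT hyT).1 hxy)
  · exact key y hyT x hxY hxT ((mono_switch_right hxT hyT).1 hxy).symm
  · exact key x hxT y hyY hyT ((mono_switch_left hxT hyT).1 hxy)
  · exact hT.mateFree hY' x hxT y hyT ((mono_switch_of_mem hxT hyT).1 hxy)

lemma covered_reselect (hx : x ∈ reselect G σ Y T) : Covered G (switch σ T) x := by
  rcases mem_reselect.1 hx with ⟨hxY, hxT⟩ | ⟨-, h⟩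
  · obtain ⟨y, hy⟩ := hYc x hxY
    have hyT : y ∉ T := fun h => hY' x (hYY' hxY) y (hT y h hy.covered_right) hy
    exact ⟨y, (mono_switch_of_notMem hxT hyT).2 hy⟩
  · exact h

/-- After the switch, uncrossing excludes bichromatic edges between `S` and `T`, and mate-freeness
of the new selection excludes monochromatic ones. Hence `S` does not notice the switch. -/
lemma inDom_of_inDom_reselect (hST : Disjoint S T)
    (hS : InDom G (switch σ T) (reselect G σ Y T) S) (hS0 : excess G (switch σ T) S ≤ 0) :
    InDom G σ Y S ∧ excess G σ S ≤ 0 ∧ ∀ x ∈ S, (Covered G σ x ↔ Covered G (switch σ T) x) := by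
  have hmf := mateFree_reselect hG hσ hYY' hYc hY' hT hT0
  have hσ' := isMaxCut_switch hG hσ (hT.mateFree hY') hT0
  have hT' : InDom G (switch σ T) (reselect G σ Y T) T :=
    fun x hx hc => mem_reselect.2 (.inr ⟨hx, hc⟩)
  have hT0' := excess_switch_self hG hσ (hT.mateFree hY') hT0
  have hSd : ∀ x ∈ S, x ∉ T := fun x hx => Finset.disjoint_left.1 hST hx
  have hnc := (uncross hG hσ' hmf hS hT' hS0 hT0').2.2
  have hM : ∀ x ∈ S, ∀ y ∈ T, ¬ Mono G σ x y := fun x hx y hy h =>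
    hnc x (Finset.mem_sdiff.2 ⟨hx, hSd x hx⟩) y
      (Finset.mem_sdiff.2 ⟨hy, Finset.disjoint_right.1 hST hy⟩)
      ((cross_switch_right (hSd x hx) hy).2 h)
  have hC : ∀ x ∈ S, ∀ y ∈ T, ¬ Cross G σ x y := by
    intro x hx y hy h
    have h' := (mono_switch_right (hSd x hx) hy).2 h
    exact hmf x (hS x hx h'.covered) y (hT' y hy h'.covered_right) h'
  have hcov : ∀ x ∈ S, (Covered G σ x ↔ Covered G (switch σ T) x) := by
    refine fun x hx => exists_congr fun y => ?_
    by_cases hy : y ∈ T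
    · rw [mono_switch_right (hSd x hx) hy]
      exact ⟨fun h => absurd h (hM x hx y hy), fun h => absurd h (hC x hx y hy)⟩
    · rw [mono_switch_of_notMem (hSd x hx) hy]
  refine ⟨fun x hx hc => ?_, ?_, hcov⟩
  · rcases mem_reselect.1 (hS x hx ((hcov x hx).1 hc)) with h | h
    · exact h.1
    · exact absurd h.1 (hSd x hx)
  · convert hS0 using 1
    have h1 : ∀ x ∈ S, weight G σ x = weight G (switch σ T) x := by
      intro x hx
      by_cases hc : Covered G σ x
      · rw [weight_of_covered hc, weight_of_covered ((hcov x hx).1 hc)]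
      · rw [weight_of_not_covered hc, weight_of_not_covered (fun h => hc ((hcov x hx).2 h))]
    rw [excess, excess, Finset.sum_congr rfl h1,
      pairs_congr fun x hx y hy => (cross_switch_of_notMem (hSd x hx) (hSd y hy)).symm]

/-- If `S` meets `T`, then `T \ S` is a proper subset without excess before the switch
(`excess_sdiff_le`), so by `hU` it misses `v` and `w`, and the edge `vw` lies in `S`. A set disjoint
from `T` is handled by the old selection. -/
lemma admissible_reselect (hY : Admissible G σ Y) (hv : v ∈ T) (hw : w ∈ T)
    (hvw : Cross G σ v w) (hvc : Covered G (switch σ T) v) (hwc : Covered G (switch σ T) w)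
    (hU : ∀ U ⊆ T, excess G σ U ≤ 0 → v ∈ U ∨ w ∈ U → U = T) :
    Admissible G (switch σ T) (reselect G σ Y T) := by
  have hmf := mateFree_reselect hG hσ hYY' hYc hY' hT hT0
  have hσ' := isMaxCut_switch hG hσ (hT.mateFree hY') hT0
  have hT' : InDom G (switch σ T) (reselect G σ Y T) T :=
    fun x hx hc => mem_reselect.2 (.inr ⟨hx, hc⟩)
  have hT0' := excess_switch_self hG hσ (hT.mateFree hY') hT0
  refine ⟨fun x => covered_reselect hG hσ hYY' hYc hY' hT hT0, hmf, fun S hS hS0 hSc => ?_⟩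
  by_cases hST : Disjoint S T
  · obtain ⟨h1, h2, h3⟩ := inDom_of_inDom_reselect hG hσ hYY' hYc hY' hT hT0 hST hS hS0
    obtain ⟨x, hx, hxc⟩ := hSc
    obtain ⟨p, hp, q, hq, hpY, hqY, hpq⟩ := hY.exists_cross S h1 h2 ⟨x, hx, (h3 x hx).2 hxc⟩
    have hpT := Finset.disjoint_left.1 hST hp
    have hqT := Finset.disjoint_left.1 hST hq
    exact ⟨p, hp, q, hq, mem_reselect.2 (.inl ⟨hpY, hpT⟩), mem_reselect.2 (.inl ⟨hqY, hqT⟩),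
      (cross_switch_of_notMem hpT hqT).2 hpq⟩
  · have h1 := (uncross hG hσ' hmf hS hT' hS0 hT0').2.1
    have h2 := excess_sdiff_le hG hσ (hT.mateFree hY') hT0 Finset.inter_subset_right h1
    have h3 : T \ (S ∩ T) ≠ T := by
      intro h
      rw [Finset.sdiff_eq_self_iff_disjoint] at h
      obtain ⟨a, ha, ha'⟩ := Finset.not_disjoint_iff.1 hST
      exact Finset.disjoint_left.1 h ha' (Finset.mem_inter.2 ⟨ha, ha'⟩)
    have h4 : ¬ (v ∈ T \ (S ∩ T) ∨ w ∈ T \ (S ∩ T)) := fun h =>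
      h3 (hU _ Finset.sdiff_subset h2 h)
    simp only [Finset.mem_sdiff, Finset.mem_inter, hv, hw, and_true, true_and, not_or,
      not_not] at h4
    exact ⟨v, h4.1, w, h4.2, hT' v hv hvc, hT' w hw hwc, (cross_switch_of_mem hv hw).2 hvw⟩

open Classical in
lemma card_reselect :
    (reselect G σ Y T).card = (Y \ T).card + (T.filter (Covered G σ)).card := by
  rw [reselect, Finset.card_union_of_disjoint, card_covered_switch hG hσ (hT.mateFree hY') hT0]
  exact Finset.sdiff_disjoint.mono_right (Finset.filter_subset _ _)

lemma source_of_source_reselect (hx : x ∉ T)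
    (h : Source G (switch σ T) (reselect G σ Y T) x) : Source G σ Y x := by
  obtain ⟨hxY, x', y, hm, hy, hc, hnc⟩ := h
  have hxY : x ∈ Y := by
    rcases mem_reselect.1 hxY with h | h
    · exact h.1
    · exact absurd h.1 hx
  have hx' : x' ∉ T := fun h => hx
    (mem_of_cross_of_mem hG hσ hYY' hYc hY' hT hT0 h hxY ((mono_switch_right hx h).1 hm).symm)
  rw [mono_switch_of_notMem hx hx'] at hm
  have hyT : y ∉ T := by
    intro h
    have := (cross_switch_right hx' h).1 hc
    obtain rfl := mono_unique hG hσ hm.symm this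
    exact hx h
  have hyY : y ∈ Y := by
    rcases mem_reselect.1 hy with h | h
    · exact h.1
    · exact absurd h.1 hyT
  exact ⟨hxY, x', y, hm, hyY, (cross_switch_of_notMem hx' hyT).1 hc,
    fun h => hnc ((cross_switch_of_notMem hx hyT).2 h)⟩

end Reselect

end SubcubicPacking

namespace SubcubicPacking

variable {V : Type*} {G : SimpleGraph V} {σ : V → Bool} {x y z e f v w : V}
  {S T Y R R' : Finset V} [DecidableEq V] [Fintype V]

/-! ### The core and conflicts between blocked ends -/

open Classical in
/-- The selected vertices that are not sources. -/
noncomputable def core (G : SimpleGraph V) (σ : V → Bool) (Y : Finset V) : Finset V :=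
  Y.filter fun x => ¬ Source G σ Y x

lemma mem_core : x ∈ core G σ Y ↔ x ∈ Y ∧ ¬ Source G σ Y x := by simp [core]

lemma core_subset : core G σ Y ⊆ Y := fun _ h => (mem_core.1 h).1

/-- A source is blocked by a selected neighbour that is not a source, the mate of a source by the
neighbour that makes it one, and an end of an unselected edge by the maximality of `Y`. Blocking is
relative to the core, which contains neither end in any of the cases. -/
lemma Optimal.exists_blocked (hG : G.IsSubcubic) (h : Optimal G σ Y) {e' : V}
    (hm : Mono G σ e e') (he : e ∉ core G σ Y) (he' : e' ∉ core G σ Y) :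
    ∃ R, Blocked G σ (core G σ Y) e R ∧ (e ∈ Y → ∃ t ∈ Y, Cross G σ e t ∧ R = {e, t}) := by
  have hσ := h.isMaxCut
  have hY := h.admissible
  by_cases heY : e ∈ Y
  · have hs : Source G σ Y e := by
      by_contra hs
      exact he (mem_core.2 ⟨heY, hs⟩)
    obtain ⟨t, ht, hc, hns⟩ := h.exists_cross_of_source hG hs
    exact ⟨{e, t}, blocked_pair hm.covered (hY.covered t ht) (mem_core.2 ⟨ht, hns⟩) hc,
      fun _ => ⟨t, ht, hc, rfl⟩⟩
  by_cases heY' : e' ∈ Y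
  · have hs : Source G σ Y e' := by
      by_contra hs
      exact he' (mem_core.2 ⟨heY', hs⟩)
    obtain ⟨-, e₂, y, hm', hy, hc, hnc⟩ := id hs
    obtain rfl := mono_unique hG hσ hm' hm.symm
    have hns : ¬ Source G σ Y y := by
      intro hys
      obtain ⟨t, ht, hyt, -⟩ := h.exists_cross_of_source hG hys
      have h1 := mono_of_cross_of_cross hG hσ hm.covered (hY.covered y hy) (hY.covered t ht) hc hyt
        (by rintro rfl; exact heY ht)
      obtain rfl := mono_unique hG hσ h1 hm
      exact hnc hyt.symm
    exact ⟨{e₂, y}, blocked_pair hm.covered (hY.covered y hy) (mem_core.2 ⟨hy, hns⟩) hc,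
      fun h => absurd h heY⟩
  have hna : ¬ Admissible G σ (insert e Y) := by
    intro ha
    have h1 := h.card_le σ _ hσ ha
    rw [Finset.card_insert_of_notMem heY] at h1
    omega
  obtain ⟨R, hR, hRc⟩ := hY.exists_blocked hG hσ hm heY' hna
  have hmf : MateFree G σ (insert e Y) :=
    mateFree_insert hY.mateFree fun y hy hey => heY' (mono_unique hG hσ hm hey ▸ hy)
  refine ⟨R, ⟨hR.mem, fun a ha hac => ?_, hR.excess_le, hR.eq_of_subset⟩, fun h => absurd h heY⟩
  rcases Finset.mem_insert.1 (hR.inDom a ha hac) with rfl | haY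
  · exact Finset.mem_insert_self _ _
  · refine Finset.mem_insert_of_mem (mem_core.2 ⟨haY, fun hs => ?_⟩)
    -- A source in `R` would pull a selected neighbour into `R`, but `R` contains no adjacent
    -- covered vertices on different sides.
    obtain ⟨t, ht, hat, -⟩ := h.exists_cross_of_source hG hs
    have htR := mem_of_cross hG hσ hmf hR.inDom hR.excess_le (Finset.mem_insert_of_mem ht)
      (hY.covered t ht) ha hat.symm
    exact hRc a ha t htR hac (hY.covered t ht) hat

section Conflict

variable (hG : G.IsSubcubic) (hσ : IsMaxCut G σ)

include hG hσ

/-- If `R` meets `T`, minimality makes the intersection all of `R`. If not, the edge `ev` joins the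
two differences, which uncrossing forbids. -/
lemma Blocked.subset_of_cross (hmf : MateFree G σ S) (hRS : InDom G σ S R)
    (hR : Blocked G σ Y e R) (hT : InDom G σ S T) (hT0 : excess G σ T ≤ 0) (hvT : v ∈ T)
    (hvR : v ∉ R) (hev : Cross G σ e v) : R ⊆ T := by
  obtain ⟨-, h1, h2⟩ := uncross hG hσ hmf hRS hT hR.excess_le hT0
  by_cases hne : (R ∩ T).Nonempty
  · rw [← hR.eq_of_subset _ Finset.inter_subset_left hne h1]
    exact Finset.inter_subset_right
  · have heT : e ∉ T := fun h => hne ⟨e, Finset.mem_inter.2 ⟨hR.mem, h⟩⟩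
    exact absurd hev (h2 e (Finset.mem_sdiff.2 ⟨hR.mem, heT⟩) v (Finset.mem_sdiff.2 ⟨hvT, hvR⟩))

/-- The only subset without excess of two blocking sets, joined by a bichromatic path through two
uncovered vertices, that contains an inner vertex of the path is the whole set. -/
lemma Blocked.eq_of_mem (hmf : MateFree G σ S) (hRS : InDom G σ S R) (hRS' : InDom G σ S R')
    (hR : Blocked G σ Y e R) (hR' : Blocked G σ Y f R') (hv : ¬ Covered G σ v)
    (hw : ¬ Covered G σ w) (hvR : v ∉ R ∪ R') (hwR : w ∉ R ∪ R') (hev : Cross G σ e v)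
    (hwf : Cross G σ w f) (hT : T ⊆ insert v (insert w (R ∪ R'))) (hT0 : excess G σ T ≤ 0)
    (hvT : v ∈ T) : T = insert v (insert w (R ∪ R')) := by
  have hQ := hRS.union hRS'
  have hTS : InDom G σ S T := ((hQ.insert_uncovered hw).insert_uncovered hv).subset hT
  have hvR1 : v ∉ R := fun h => hvR (Finset.mem_union_left _ h)
  have hwR1 : w ∉ R' := fun h => hwR (Finset.mem_union_right _ h)
  have hRT := hR.subset_of_cross hG hσ hmf hRS hTS hT0 hvT hvR1 hev
  have hQ0 := (uncross hG hσ hmf hRS hRS' hR.excess_le hR'.excess_le).1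
  have hwT : w ∈ T := by
    -- Parity: without `w`, the set `insert v (R ∪ R')` would have excess 0, but `R ∪ R'` already
    -- has excess 0 and adding `v` changes it by an odd number 3 - 2k.
    by_contra hwT
    have h1 := (uncross hG hσ hmf hTS hQ hT0 hQ0).1
    have h2 : T ∪ (R ∪ R') = insert v (R ∪ R') := by
      ext a
      constructor
      · intro ha
        rcases Finset.mem_union.1 ha with ha | ha
        · rcases Finset.mem_insert.1 (hT ha) with rfl | ha'
          · exact Finset.mem_insert_self _ _
          · rcases Finset.mem_insert.1 ha' with rfl | ha''
            · exact absurd ha hwT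
            · exact Finset.mem_insert_of_mem ha''
        · exact Finset.mem_insert_of_mem ha
      · intro ha
        rcases Finset.mem_insert.1 ha with rfl | ha
        · exact Finset.mem_union_left _ hvT
        · exact Finset.mem_union_right _ ha
    have h3 := excess_insert (G := G) (σ := σ) hvR
    have h4 := excess_nonneg hG hσ (hQ.mateFree hmf)
    have h5 := excess_nonneg hG hσ ((hQ.insert_uncovered hv).mateFree hmf)
    rw [h2] at h1
    rw [weight_of_not_covered hv] at h3
    omega
  have hRT' := hR'.subset_of_cross hG hσ hmf hRS' hTS hT0 hwT hwR1 hwf.symm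
  refine hT.antisymm ?_
  intro a ha
  rcases Finset.mem_insert.1 ha with rfl | ha
  · exact hvT
  rcases Finset.mem_insert.1 ha with rfl | ha
  · exact hwT
  · exact Finset.union_subset hRT hRT' ha

end Conflict

/-- The vertex of a blocking pair that is a source becomes uncovered when switching. -/
lemma not_covered_switch (hG : G.IsSubcubic) (hT : MateFree G σ T) {t : V}
    (hm : Covered G σ e) (he : e ∈ T) (ht : t ∈ T) (hv : v ∈ T) (htv : t ≠ v) (het : Cross G σ e t)
    (hev : Cross G σ e v) : ¬ Covered G (switch σ T) e := by
  rintro ⟨y, hy⟩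
  by_cases hyT : y ∈ T
  · exact hT e he y hyT ((mono_switch_of_mem he hyT).1 hy)
  · rw [mono_switch_left he hyT] at hy
    obtain ⟨e', hm⟩ := hm
    have h1 := three_le_pairs (r := Cross G σ) (z := e) htv
      (by rintro rfl; exact hyT ht : t ≠ y) (by rintro rfl; exact hyT hv : v ≠ y)
      (Finset.mem_univ _) (Finset.mem_univ _) (Finset.mem_univ _) het hev hy
    have h2 := one_le_pairs (Finset.mem_singleton_self e) (Finset.mem_univ _) hm
    have h3 := pairs_adj_le_three hG e .univ
    rw [pairs_adj G σ] at h3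
    omega

/-- An uncovered vertex is adjacent to at most one end of an edge between selected vertices. -/
lemma Admissible.not_cross_pair (hG : G.IsSubcubic) (hσ : IsMaxCut G σ) (hY : Admissible G σ Y)
    {a b c : V} (ha : a ∈ Y) (hb : b ∈ Y) (hc : ¬ Covered G σ c) (hab : Cross G σ a b)
    (hca : Cross G σ c a) : ¬ Cross G σ c b := by
  intro hcb
  have hac := hY.covered a ha
  have hbc := hY.covered b hb
  have hdab : InDom G σ Y {a, b} := by
    intro x hx _
    rcases Finset.mem_insert.1 hx with rfl | hx
    · exact ha
    · rwa [Finset.mem_singleton.1 hx]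
  have h1 := (blocked_pair hac hbc hb hab).excess_le
  have hcab : c ∉ ({a, b} : Finset V) := by
    simp only [Finset.mem_insert, Finset.mem_singleton]
    rintro (rfl | rfl)
    · exact hc hac
    · exact hc hbc
  have h2 := excess_insert_le_of_two hcab hab.ne (by simp) (by simp) hca hcb
  have h3 := excess_nonneg hG hσ ((hdab.insert_uncovered hc).mateFree hY.mateFree)
  rw [weight_of_not_covered hc] at h2
  omega

/-- Switching along two pairs of selected vertices with sources, joined by a bichromatic path
through two uncovered vertices, leads to a selection with fewer sources. -/
lemma Optimal.not_admissible_reselect (hG : G.IsSubcubic) (h : Optimal G σ Y)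
    {t s : V} (hes : Source G σ Y e) (hfs : Source G σ Y f) (hef : e ≠ f) (hesne : e ≠ s)
    (ht : t ∈ Y) (hs : s ∈ Y) (het : Cross G σ e t) (hfs' : Cross G σ f s)
    (hev : Cross G σ e v) (hvw : Cross G σ v w) (hwf : Cross G σ w f)
    (hv : ¬ Covered G σ v) (hw : ¬ Covered G σ w) (hts : ¬ Cross G σ t s) (htw : ¬ Cross G σ t w)
    (hsv : ¬ Cross G σ s v) (hT : InDom G σ Y T) (hT0 : excess G σ T ≤ 0) (hvT : v ∈ T)
    (hwT : w ∈ T) (heT : e ∈ T) (htT : t ∈ T) (hfT : f ∈ T) (hsT : s ∈ T)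
    (hmemT : ∀ {a}, a ∈ T → a = v ∨ a = w ∨ a = e ∨ a = t ∨ a = f ∨ a = s)
    (hcardY : (reselect G σ Y T).card = Y.card) :
    ¬ Admissible G (switch σ T) (reselect G σ Y T) := by
  intro hadm
  have hσ := h.isMaxCut
  have hY := h.admissible
  have hYc := hY.covered
  have hYY' : Y ⊆ Y := subset_rfl
  have hmf := hY.mateFree
  have hTmf := hT.mateFree hmf
  have hσ' := isMaxCut_switch hG hσ hTmf hT0
  have he := hYc e hes.1
  have hf := hYc f hfs.1
  have htv : t ≠ v := by rintro rfl; exact hv (hYc _ ht)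
  have hsw : s ≠ w := by rintro rfl; exact hw (hYc _ hs)
  -- The sources `e` and `f` become uncovered and leave the selection. Then `t` and `s` have no
  -- selected neighbours and can be made non-sources, and at most one of `v`, `w` needs to remain a
  -- source. So two sources disappear and at most one arises.
  have hec := not_covered_switch hG hTmf he heT htT hvT htv het hev
  have hfc := not_covered_switch hG hTmf hf hfT hsT hwT hsw hfs' hwf.symm
  have hcov := fun {x} => covered_reselect (x := x) hG hσ hYY' hYc hmf hT hT0
  have hnt : ∀ u ∈ reselect G σ Y T, ¬ Cross G (switch σ T) t u := by
    intro u hu hc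
    by_cases huT : u ∈ T
    · rw [cross_switch_of_mem htT huT] at hc
      rcases hmemT huT with rfl | rfl | rfl | rfl | rfl | rfl
      · exact hY.not_cross_pair hG hσ hes.1 ht hv het hev.symm hc.symm
      · exact htw hc
      · exact hec (hcov hu)
      · exact hc.ne rfl
      · exact hfc (hcov hu)
      · exact hts hc
    · rw [cross_switch_left htT huT] at hc
      rcases mem_reselect.1 hu with hu | hu
      · exact hY.mateFree t ht u hu.1 hc
      · exact huT hu.1
  have hns : ∀ u ∈ reselect G σ Y T, ¬ Cross G (switch σ T) s u := by
    intro u hu hc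
    by_cases huT : u ∈ T
    · rw [cross_switch_of_mem hsT huT] at hc
      rcases hmemT huT with rfl | rfl | rfl | rfl | rfl | rfl
      · exact hsv hc
      · exact hY.not_cross_pair hG hσ hfs.1 hs hw hfs' hwf hc.symm
      · exact hec (hcov hu)
      · exact hts hc.symm
      · exact hfc (hcov hu)
      · exact hc.ne rfl
    · rw [cross_switch_left hsT huT] at hc
      rcases mem_reselect.1 hu with hu | hu
      · exact hY.mateFree s hs u hu.1 hc
      · exact huT hu.1
  obtain ⟨Z₁, hZ₁, hc₁, -, hsub₁, hs₁⟩ := hadm.exists_not_source hG hσ' hnt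
  have hns₁ : ∀ u ∈ Z₁, ¬ Cross G (switch σ T) s u := by
    intro u hu hc
    rcases hsub₁ u hu with hu | hu
    · exact hns u hu hc
    · by_cases huT : u ∈ T
      · exact hTmf t htT u huT ((mono_switch_of_mem htT huT).1 hu)
      · rw [mono_switch_left htT huT] at hu
        rw [cross_switch_left hsT huT] at hc
        have h1 := mono_of_cross_of_cross hG hσ he (hYc t ht) hc.covered_right het hu
          (by rintro rfl; exact huT heT)
        obtain rfl := mono_unique hG hσ hc.symm h1.symm
        exact hesne rfl
  obtain ⟨Z₂, hZ₂, hc₂, -, -, hs₂⟩ := hZ₁.exists_not_source hG hσ' hns₁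
  obtain ⟨Z₃, hZ₃, hc₃, hs₃, hs₃'⟩ : ∃ Z, Admissible G (switch σ T) Z ∧ Z.card = Z₂.card ∧
      (∀ u, Source G (switch σ T) Z u → Source G (switch σ T) Z₂ u) ∧
      ¬ (Source G (switch σ T) Z v ∧ Source G (switch σ T) Z w) := by
    by_cases hb : Source G (switch σ T) Z₂ v ∧ Source G (switch σ T) Z₂ w
    · obtain ⟨Z, hZ, hZc, hZs⟩ := hZ₂.exists_not_source_of_cross hG hσ' hb.1 hb.2
        ((cross_switch_of_mem hvT hwT).2 hvw)
      exact ⟨Z, hZ, hZc, fun u hu => (hZs u hu).1, fun hb' => (hZs v hb'.1).2.1 rfl⟩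
    · exact ⟨Z₂, hZ₂, rfl, fun u hu => hu, hb⟩
  have hsrc : ∀ u, Source G (switch σ T) Z₃ u →
      u = v ∨ u = w ∨ u ∈ ((sources G σ Y).erase e).erase f := by
    intro u hu
    obtain ⟨h1, hus⟩ := hs₂ u (hs₃ u hu)
    obtain ⟨h2, hut⟩ := hs₁ u h1
    by_cases huT : u ∈ T
    · rcases hmemT huT with h | h | rfl | rfl | rfl | rfl
      · exact .inl h
      · exact .inr (.inl h)
      · exact absurd (hcov h2.1) hec
      · exact absurd rfl hut
      · exact absurd (hcov h2.1) hfc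
      · exact absurd rfl hus
    · refine .inr (.inr (Finset.mem_erase.2 ⟨?_, Finset.mem_erase.2 ⟨?_, mem_sources.2
        (source_of_source_reselect hG hσ hYY' hYc hmf hT hT0 huT h2)⟩⟩))
      · rintro rfl; exact huT hfT
      · rintro rfl; exact huT heT
  have hmin := h.sources_le _ Z₃ hσ' hZ₃ (by rw [hc₃, hc₂, hc₁, hcardY])
  have hc1 := Finset.card_erase_add_one (mem_sources.2 hes)
  have hc2 := Finset.card_erase_add_one
    (Finset.mem_erase.2 ⟨hef.symm, mem_sources.2 hfs⟩ : f ∈ (sources G σ Y).erase e)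
  have hsub : ∃ a, sources G (switch σ T) Z₃ ⊆ insert a (((sources G σ Y).erase e).erase f) := by
    by_cases hb : Source G (switch σ T) Z₃ v
    · refine ⟨v, fun u hu => ?_⟩
      rcases hsrc u (mem_sources.1 hu) with rfl | rfl | hu'
      · exact Finset.mem_insert_self _ _
      · exact absurd ⟨hb, mem_sources.1 hu⟩ hs₃'
      · exact Finset.mem_insert_of_mem hu'
    · refine ⟨w, fun u hu => ?_⟩
      rcases hsrc u (mem_sources.1 hu) with rfl | rfl | hu'
      · exact absurd (mem_sources.1 hu) hb
      · exact Finset.mem_insert_self _ _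
      · exact Finset.mem_insert_of_mem hu'
  obtain ⟨a, ha⟩ := hsub
  have h1 := Finset.card_le_card ha
  have h2 := Finset.card_insert_le a (((sources G σ Y).erase e).erase f)
  omega

/-- Two blocked vertices of an optimal selection are not joined by a bichromatic path with two
uncovered inner vertices outside the blocking sets. -/
lemma Optimal.not_path (hG : G.IsSubcubic) (h : Optimal G σ Y)
    (hmf : MateFree G σ (insert e (insert f Y))) (he : Covered G σ e) (hf : Covered G σ f)
    (hef : e ≠ f) (hR : Blocked G σ Y e R) (hR' : Blocked G σ Y f R') (hd : Disjoint R R')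
    (hev : Cross G σ e v) (hvw : Cross G σ v w) (hwf : Cross G σ w f)
    (hv : ¬ Covered G σ v) (hw : ¬ Covered G σ w) (hvR : v ∉ R ∪ R') (hwR : w ∉ R ∪ R')
    (hes : e ∈ Y → Source G σ Y e ∧ ∃ t ∈ Y, Cross G σ e t ∧ R = {e, t})
    (hfs : f ∈ Y → Source G σ Y f ∧ ∃ t ∈ Y, Cross G σ f t ∧ R' = {f, t}) : False := by
  classical
  have hσ := h.isMaxCut
  have hY := h.admissible
  have hdR := Blocked.inDom_left hG hσ hmf hR hR'
  have hdR' := Blocked.inDom_right hG hσ hmf hR hR'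
  have hQ := hdR.union hdR'
  have hQ0 := (uncross hG hσ hmf hdR hdR' hR.excess_le hR'.excess_le).1
  obtain ⟨T, hTdef⟩ : ∃ T, T = insert v (insert w (R ∪ R')) := ⟨_, rfl⟩
  have hTdef' : T = insert w (insert v (R' ∪ R)) := by
    rw [hTdef, Finset.insert_comm, Finset.union_comm]
  have hwQ1 := excess_insert_le hwR (Finset.mem_union_right _ hR'.mem) hwf
  have hvQ1 := excess_insert_le hvR (Finset.mem_union_left _ hR.mem) hev.symm
  rw [weight_of_not_covered hw] at hwQ1
  rw [weight_of_not_covered hv] at hvQ1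
  have hvwR : v ∉ insert w (R ∪ R') := by simp only [Finset.mem_insert, hvw.ne, hvR, or_self,
    not_false_eq_true]
  have hwvR : w ∉ insert v (R' ∪ R) := by
    rw [Finset.union_comm]
    simp only [Finset.mem_insert, hvw.ne.symm, hwR, or_self, not_false_eq_true]
  have hwe : w ≠ e := by rintro rfl; exact hwR (Finset.mem_union_left _ hR.mem)
  have hT : InDom G σ (insert e (insert f Y)) T := by
    rw [hTdef]
    exact (hQ.insert_uncovered hw).insert_uncovered hv
  have hTmf := hT.mateFree hmf
  -- Adding `w` contributes at most 3 - 2 = 1, then `v`, adjacent to both `w` and `e`, at most 3 - 4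
  -- = -1.
  have hT0 : excess G σ T ≤ 0 := by
    have := excess_insert_le_of_two hvwR hwe (Finset.mem_insert_self _ _)
      (Finset.mem_insert_of_mem (Finset.mem_union_left _ hR.mem)) hvw hev.symm
    rw [weight_of_not_covered hv, ← hTdef] at this
    omega
  have hvT : v ∈ T := by rw [hTdef]; exact Finset.mem_insert_self _ _
  have hwT : w ∈ T := by rw [hTdef']; exact Finset.mem_insert_self _ _
  have hRT : R ⊆ T := by
    intro a ha
    rw [hTdef]
    exact Finset.mem_insert_of_mem (Finset.mem_insert_of_mem (Finset.mem_union_left _ ha))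
  have hRT' : R' ⊆ T := by
    intro a ha
    rw [hTdef]
    exact Finset.mem_insert_of_mem (Finset.mem_insert_of_mem (Finset.mem_union_right _ ha))
  have hvc : Covered G (switch σ T) v := by
    refine covered_switch_of_erase hG hσ hTmf hT0 hvT hv ?_
    rw [hTdef, Finset.erase_insert hvwR]
    omega
  have hwc : Covered G (switch σ T) w := by
    refine covered_switch_of_erase hG hσ hTmf hT0 hwT hw ?_
    rw [hTdef', Finset.erase_insert hwvR, Finset.union_comm]
    omega
  have hYY' : Y ⊆ insert e (insert f Y) := fun a ha => by simp [ha]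
  have hYc := hY.covered
  have hU : ∀ U ⊆ T, excess G σ U ≤ 0 → v ∈ U ∨ w ∈ U → U = T := by
    rintro U hUT hU0 (hvU | hwU)
    · rw [hTdef] at hUT ⊢
      exact Blocked.eq_of_mem hG hσ hmf hdR hdR' hR hR' hv hw hvR hwR hev hwf hUT hU0 hvU
    · rw [hTdef'] at hUT ⊢
      rw [Finset.union_comm] at hvR hwR
      exact Blocked.eq_of_mem hG hσ hmf hdR' hdR hR' hR hw hv hwR hvR hwf.symm hev.symm hUT hU0 hwU
  have hσ' := isMaxCut_switch hG hσ hTmf hT0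
  have hadm := admissible_reselect hG hσ hYY' hYc hmf hT hT0 hY hvT hwT hvw hvc hwc hU
  have hcard := card_reselect hG hσ hYY' hYc hmf hT hT0
  have hle := h.card_le _ _ hσ' hadm
  have hsplit := Finset.card_sdiff_add_card_inter Y T
  -- The new selection has in `T` as many vertices as were covered there before, so by maximality of
  -- `Y` all of these were already selected.
  have hnew : ∀ a ∈ T, a ∉ Y → Covered G σ a → False := by
    intro a haT haY hac
    have h1 : insert a (Y ∩ T) ⊆ T.filter (Covered G σ) := by
      intro b hb
      rcases Finset.mem_insert.1 hb with rfl | hb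
      · exact Finset.mem_filter.2 ⟨haT, hac⟩
      · obtain ⟨hb1, hb2⟩ := Finset.mem_inter.1 hb
        exact Finset.mem_filter.2 ⟨hb2, hYc b hb1⟩
    have h2 := Finset.card_le_card h1
    rw [Finset.card_insert_of_notMem (by simp [haY])] at h2
    omega
  have heT := hRT hR.mem
  have hfT := hRT' hR'.mem
  have heY : e ∈ Y := by_contra fun hn => hnew e heT hn he
  have hfY : f ∈ Y := by_contra fun hn => hnew f hfT hn hf
  obtain ⟨hes', t, ht, het, rfl⟩ := hes heY
  obtain ⟨hfs₁, s, hs, hfs', rfl⟩ := hfs hfY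
  have htT : t ∈ T := hRT (by simp)
  have hsT : s ∈ T := hRT' (by simp)
  have hcardY : (reselect G σ Y T).card = Y.card := by
    have h1 : T.filter (Covered G σ) = Y ∩ T := by
      ext a
      simp only [Finset.mem_filter, Finset.mem_inter]
      exact ⟨fun ha => ⟨by_contra fun hn => hnew a ha.1 hn ha.2, ha.1⟩,
        fun ha => ⟨ha.2, hYc a ha.1⟩⟩
    rw [hcard, h1, hsplit]
  have hncr := fun {x y} => Blocked.not_cross (x := x) (y := y) hG hσ hmf hR hR' hd
  have hncom := fun {x y v} =>
    Blocked.not_common (x := x) (y := y) (v := v) hG hσ hmf hR hR' hd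
  have het' : t ∈ ({e, t} : Finset V) := Finset.mem_insert_of_mem (Finset.mem_singleton_self t)
  have hfs'' : s ∈ ({f, s} : Finset V) := Finset.mem_insert_of_mem (Finset.mem_singleton_self s)
  have hinsert : insert e (insert f Y) = Y := by
    rw [Finset.insert_eq_of_mem hfY, Finset.insert_eq_of_mem heY]
  refine h.not_admissible_reselect hG hes' hfs₁ hef ?_ ht hs het hfs' hev hvw hwf hv hw
    (hncr het' hfs'') (fun hc => hncom het' hR'.mem hc.symm hwf)
    (fun hc => hncom hR.mem hfs'' hev.symm hc.symm) (hinsert ▸ hT) hT0 hvT hwT heT htT hfT hsT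
    ?_ hcardY hadm
  · rintro rfl
    exact Finset.disjoint_left.1 hd hR.mem hfs''
  · intro a ha
    rw [hTdef] at ha
    simp only [Finset.mem_insert, Finset.mem_union, Finset.mem_singleton] at ha
    tauto

end SubcubicPacking

namespace SubcubicPacking

variable {V : Type*} {G : SimpleGraph V} {σ : V → Bool} {x y z e f v w : V}
  {S T Y R R' C : Finset V}

/-! ### Two-colouring the selected vertices -/

/-- A relation such that every nonempty subset of `A` has an element related to at most one other
element of the subset is two-colourable. -/
lemma exists_two_coloring [DecidableEq V] {r : V → V → Prop} (hr : ∀ x y, r x y → r y x)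
    (A : Finset V)
    (h : ∀ C ⊆ A, C.Nonempty → ∃ x ∈ C, ∀ y ∈ C, ∀ z ∈ C, y ≠ x → z ≠ x → r x y → r x z → y = z) :
    ∃ c : V → Bool, ∀ x ∈ A, ∀ y ∈ A, x ≠ y → r x y → c x ≠ c y := by
  induction A using Finset.strongInduction with
  | H A ih =>
    rcases A.eq_empty_or_nonempty with rfl | hA
    · exact ⟨fun _ => true, by simp⟩
    obtain ⟨x, hx, hx1⟩ := h A subset_rfl hA
    obtain ⟨c, hc⟩ := ih (A.erase x) (Finset.erase_ssubset hx)
      fun C hC => h C (hC.trans (Finset.erase_subset _ _))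
    obtain ⟨b, hb⟩ : ∃ b, ∀ y ∈ A, y ≠ x → r x y → b ≠ c y := by
      by_cases hy : ∃ y ∈ A, y ≠ x ∧ r x y
      · obtain ⟨y, hyA, hyx, hxy⟩ := hy
        refine ⟨!c y, fun z hz hzx hxz => ?_⟩
        rw [hx1 z hz y hyA hzx hyx hxz hxy]
        simp
      · push Not at hy
        exact ⟨true, fun y hyA hyx hxy => absurd hxy (hy y hyA hyx)⟩
    refine ⟨Function.update c x b, fun y hy z hz hyz hryz => ?_⟩
    by_cases hyx : y = x
    · subst hyx
      rw [Function.update_self, Function.update_of_ne hyz.symm]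
      exact hb z hz hyz.symm hryz
    · by_cases hzx : z = x
      · subst hzx
        rw [Function.update_self, Function.update_of_ne hyx]
        exact (hb y hy hyx (hr _ _ hryz)).symm
      · rw [Function.update_of_ne hyx, Function.update_of_ne hzx]
        exact hc y (by simp [hy, hyx]) z (by simp [hz, hzx]) hyz hryz

/-- Vertices joined by a bichromatic edge, or by a bichromatic path through an uncovered vertex. -/
def Linked (G : SimpleGraph V) (σ : V → Bool) (x y : V) : Prop :=
  Cross G σ x y ∨ ∃ z, ¬ Covered G σ z ∧ Cross G σ z x ∧ Cross G σ z y

lemma Linked.symm (h : Linked G σ x y) : Linked G σ y x := by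
  rcases h with h | ⟨z, hz, h1, h2⟩
  · exact .inl h.symm
  · exact .inr ⟨z, hz, h2, h1⟩

variable [DecidableEq V] [Fintype V]

section Linked

variable (hG : G.IsSubcubic) (hσ : IsMaxCut G σ) (hY : Admissible G σ Y)

include hG hσ hY

lemma excess_of_subset (hC : C ⊆ Y) : excess G σ C = C.card - pairs (Cross G σ) C C := by
  rw [excess, Finset.sum_congr rfl fun x hx => weight_of_covered (hY.covered x (hC hx))]
  simp

/-- With a set A of at least three selected neighbours, `z` and A have excess at most 3 - |A| ≤ 0.
Admissibility then gives an edge inside A, which makes the excess negative. -/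
lemma pairs_cross_le_two (hC : C ⊆ Y) (hz : ¬ Covered G σ z) : pairs (Cross G σ) {z} C ≤ 2 := by
  classical
  by_contra! h
  rw [pairs_singleton_eq_card] at h
  set A := C.filter (Cross G σ z) with hA
  have hAY : A ⊆ Y := (Finset.filter_subset _ _).trans hC
  have hzA : z ∉ A := fun h => hz (hY.covered z (hAY h))
  have h1 : pairs (Cross G σ) {z} A = A.card := by
    rw [pairs_singleton_eq_card, Finset.filter_eq_self.2]
    exact fun a ha => (Finset.mem_filter.1 ha).2
  have h2 := excess_insert (G := G) (σ := σ) hzA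
  have h3 := excess_of_subset hG hσ hY hAY
  have h4 := pairs_nonneg (r := Cross G σ) (S := A) (T := A)
  rw [weight_of_not_covered hz, h1, h3] at h2
  have hdom : InDom G σ Y (insert z A) :=
    InDom.insert_uncovered (fun a ha _ => hAY ha) hz
  have h5 := excess_nonneg hG hσ (hdom.mateFree hY.mateFree)
  obtain ⟨a, ha⟩ := Finset.card_pos.1 (by omega : 0 < A.card)
  obtain ⟨p, hp, q, hq, hpY, hqY, hpq⟩ := hY.exists_cross _ hdom (by omega)
    ⟨a, Finset.mem_insert_of_mem ha, hY.covered a (hAY ha)⟩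
  have hmem : ∀ a ∈ insert z A, a ∈ Y → a ∈ A := by
    intro a ha haY
    rcases Finset.mem_insert.1 ha with rfl | ha
    · exact absurd (hY.covered _ haY) hz
    · exact ha
  have h6 := one_le_pairs (hmem p hp hpY) (hmem q hq hqY) hpq
  omega

/-- Let Z be the uncovered vertices with two, hence exactly two, neighbours in `C`. If every vertex
of `C` had two links, it would have two bichromatic neighbours in C ∪ Z, and double counting gives C
∪ Z no excess. Admissibility then yields an edge inside `C`, and counting it makes the excess
negative. -/
lemma exists_linked_le_one (hC : C ⊆ Y) (hne : C.Nonempty) :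
    ∃ x ∈ C, ∀ y ∈ C, ∀ z ∈ C, y ≠ x → z ≠ x → Linked G σ x y → Linked G σ x z → y = z := by
  classical
  by_contra! hcon
  set Z : Finset V := Finset.univ.filter fun z => ¬ Covered G σ z ∧
    ∃ a ∈ C, ∃ b ∈ C, a ≠ b ∧ Cross G σ z a ∧ Cross G σ z b with hZ
  have hmemZ : ∀ {z}, z ∈ Z ↔ ¬ Covered G σ z ∧
      ∃ a ∈ C, ∃ b ∈ C, a ≠ b ∧ Cross G σ z a ∧ Cross G σ z b := by
    intro z; simp [hZ]
  have hd : Disjoint C Z := Finset.disjoint_left.2 fun a ha ha' =>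
    (hmemZ.1 ha').1 (hY.covered a (hC ha))
  have h1 : pairs (Cross G σ) Z C = 2 * Z.card := by
    rw [pairs_eq_sum, Finset.sum_congr rfl fun z hz => ?_, Finset.sum_const, nsmul_eq_mul, mul_comm]
    obtain ⟨hzc, a, ha, b, hb, hab, hza, hzb⟩ := hmemZ.1 hz
    exact le_antisymm (pairs_cross_le_two hG hσ hY hC hzc) (two_le_pairs hab ha hb hza hzb)
  have h2 : ∀ x ∈ C, 2 ≤ pairs (Cross G σ) {x} (C ∪ Z) := by
    intro x hx
    obtain ⟨y, hy, z, hz, hyx, hzx, hxy, hxz, hyz⟩ := hcon x hx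
    have hin : ∀ {a u}, a ∈ C → a ≠ x → ¬ Covered G σ u → Cross G σ u x → Cross G σ u a → u ∈ Z :=
      fun ha hax hu hux hua => hmemZ.2 ⟨hu, x, hx, _, ha, hax.symm, hux, hua⟩
    rcases hxy with hxy | ⟨u, hu, hux, huy⟩ <;> rcases hxz with hxz | ⟨u', hu', hux', huz⟩
    · exact two_le_pairs hyz (Finset.mem_union_left _ hy) (Finset.mem_union_left _ hz) hxy hxz
    · exact two_le_pairs (by rintro rfl; exact hu' (hY.covered _ (hC hy)))
        (Finset.mem_union_left _ hy) (Finset.mem_union_right _ (hin hz hzx hu' hux' huz)) hxy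
        hux'.symm
    · exact two_le_pairs (by rintro rfl; exact hu (hY.covered _ (hC hz)))
        (Finset.mem_union_right _ (hin hy hyx hu hux huy)) (Finset.mem_union_left _ hz) hux.symm hxz
    · refine two_le_pairs ?_ (Finset.mem_union_right _ (hin hy hyx hu hux huy))
        (Finset.mem_union_right _ (hin hz hzx hu' hux' huz)) hux.symm hux'.symm
      rintro rfl
      have h3 := three_le_pairs hyx.symm hzx.symm hyz hx hy hz hux huy huz
      have h4 := pairs_cross_le_two hG hσ hY hC hu
      omega
  have h3 : 2 * (C.card : ℤ) ≤ pairs (Cross G σ) C C + pairs (Cross G σ) C Z := by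
    rw [← pairs_union_right hd, pairs_eq_sum]
    have := Finset.sum_le_sum h2
    rw [Finset.sum_const, nsmul_eq_mul] at this
    linarith
  have h4 := excess_disjUnion (G := G) (σ := σ) hd
  have h5 := excess_of_subset hG hσ hY hC
  have h6 : excess G σ Z = 3 * Z.card - pairs (Cross G σ) Z Z := by
    rw [excess, Finset.sum_congr rfl fun z hz => weight_of_not_covered (hmemZ.1 hz).1,
      Finset.sum_const, nsmul_eq_mul, mul_comm]
  have h7 := pairs_nonneg (r := Cross G σ) (S := Z) (T := Z)
  have h8 := pairs_nonneg (r := Cross G σ) (S := C) (T := C)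
  rw [pairs_cross_comm] at h1
  have hdom : InDom G σ Y (C ∪ Z) := InDom.union (fun a ha _ => hC ha)
    fun a ha hc => absurd hc (hmemZ.1 ha).1
  have h9 := excess_nonneg hG hσ (hdom.mateFree hY.mateFree)
  obtain ⟨a, ha⟩ := hne
  obtain ⟨p, hp, q, hq, hpY, hqY, hpq⟩ := hY.exists_cross _ hdom (by omega)
    ⟨a, Finset.mem_union_left _ ha, hY.covered a (hC ha)⟩
  have hmem : ∀ a ∈ C ∪ Z, a ∈ Y → a ∈ C := by
    intro a ha haY
    rcases Finset.mem_union.1 ha with ha | ha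
    · exact ha
    · exact absurd (hY.covered a haY) (hmemZ.1 ha).1
  have h10 := one_le_pairs (hmem p hp hpY) (hmem q hq hqY) hpq
  omega

end Linked

/-! ### Colouring finite graphs -/

/-- `u` and `v` are far enough apart to share the colour `i` in a `(1, 1, 2, 2, 3)`-colouring. -/
def Separated (G : SimpleGraph V) (i : Fin 5) (u v : V) : Prop :=
  ¬ G.Adj u v ∧ (2 ≤ i → ∀ a, G.Adj u a → ¬ G.Adj a v) ∧
    (i = 4 → ∀ a b, G.Adj u a → G.Adj a b → ¬ G.Adj b v)

lemma mateFree_insert_insert (hG : G.IsSubcubic) (hσ : IsMaxCut G σ) (hY : MateFree G σ Y)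
    {e' f' : V} (he : Mono G σ e e') (he' : e' ∉ Y) (hf : Mono G σ f f') (hf' : f' ∉ Y)
    (hne : e' ≠ f) : MateFree G σ (insert e (insert f Y)) := by
  refine mateFree_insert (mateFree_insert hY fun y hy h => ?_) fun y hy h => ?_
  · exact hf' (mono_unique hG hσ hf h ▸ hy)
  · obtain rfl := mono_unique hG hσ he h
    rcases Finset.mem_insert.1 hy with rfl | hy
    · exact hne rfl
    · exact he' hy

/-- Far-apartness of two blocked edges. -/
lemma Optimal.separated (hG : G.IsSubcubic) (h : Optimal G σ Y) {e' f' : V} (hef : e ≠ f)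
    (hef' : e' ≠ f) (hme : Mono G σ e e') (hmf : Mono G σ f f') (he' : e' ∉ Y) (hf' : f' ∉ Y)
    (he : e ∈ Y → Source G σ Y e) (hf : f ∈ Y → Source G σ Y f) : Separated G 4 e f := by
  have hσ := h.isMaxCut
  have hY := h.admissible
  have hXmf : MateFree G σ (core G σ Y) := hY.mateFree.subset core_subset
  have hcX : ∀ {a}, (a ∈ Y → Source G σ Y a) → a ∉ core G σ Y := fun ha ha' =>
    (mem_core.1 ha').2 (ha (mem_core.1 ha').1)
  have heX := hcX he
  have hfX := hcX hf
  have heX' : e' ∉ core G σ Y := fun h => he' (core_subset h)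
  have hfX' : f' ∉ core G σ Y := fun h => hf' (core_subset h)
  have hne1 : e ≠ f' := by rintro rfl; exact hef' (mono_unique hG hσ hme hmf.symm)
  have hne2 : e' ≠ f' := by rintro rfl; exact hef (mono_unique hG hσ hme.symm hmf.symm)
  obtain ⟨R, hR, hRp⟩ := h.exists_blocked hG hme heX heX'
  obtain ⟨Q, hQ, -⟩ := h.exists_blocked hG hme.symm heX' heX
  obtain ⟨R', hR', hRp'⟩ := h.exists_blocked hG hmf hfX hfX'
  obtain ⟨Q', hQ', -⟩ := h.exists_blocked hG hmf.symm hfX' hfX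
  -- This is applied to all four pairs of ends of the two edges, because a path that starts or stops
  -- with a monochromatic step passes through a mate.
  have key : ∀ {a a' b b' : V} {A B : Finset V}, Blocked G σ (core G σ Y) a A →
      Blocked G σ (core G σ Y) b B → Mono G σ a a' → Mono G σ b b' → a ∉ core G σ Y →
      a' ∉ core G σ Y → b' ∉ core G σ Y → a ≠ b → a' ≠ b →
      ¬ Cross G σ a b ∧ ∀ v, Cross G σ a v → ¬ Cross G σ v b := by
    intro a a' b b' A B hA hB hma hmb ha ha' hb' hab hab'
    have hmf := mateFree_insert_insert hG hσ hXmf hma ha' hmb hb' hab'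
    have hd := Blocked.disjoint hG hσ hmf hA hB hma.covered ha hab
    exact ⟨Blocked.not_cross hG hσ hmf hA hB hd hA.mem hB.mem, fun v h1 h2 =>
      Blocked.not_common hG hσ hmf hA hB hd hA.mem hB.mem h1.symm h2⟩
  have k1 := key hR hR' hme hmf heX heX' hfX' hef hef'
  have k2 := key hQ hR' hme.symm hmf heX' heX hfX' hef' hef
  have k3 := key hR hQ' hme hmf.symm heX heX' hfX hne1 hne2
  have k4 := key hQ hQ' hme.symm hmf.symm heX' heX hfX hne2 hne1
  have far1 : ¬ G.Adj e f := by
    intro ha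
    rcases mono_or_cross (σ := σ) ha with hm | hc
    · exact hef' (mono_unique hG hσ hme hm)
    · exact k1.1 hc
  refine ⟨far1, fun _ v hev hvf => ?_, fun _ v w hev hvw hwf => ?_⟩
  · rcases mono_or_cross (σ := σ) hev with hev | hev <;>
      rcases mono_or_cross (σ := σ) hvf with hvf | hvf
    · obtain rfl := mono_unique hG hσ hme hev
      exact hef (mono_unique hG hσ hme.symm hvf)
    · obtain rfl := mono_unique hG hσ hme hev
      exact k2.1 hvf
    · obtain rfl := mono_unique hG hσ hmf hvf.symm
      exact k3.1 hev
    · exact k1.2 v hev hvf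
  have hmfX := mateFree_insert_insert hG hσ hXmf hme heX' hmf hfX' hef'
  have hd := Blocked.disjoint hG hσ hmfX hR hR' hme.covered heX hef
  -- Two consecutive monochromatic steps return to their start, and a monochromatic first or last
  -- step leads to a mate and leaves a shorter path. The cases with real content are a monochromatic
  -- middle step alone and a wholly bichromatic path.
  rcases mono_or_cross (σ := σ) hev with hev | hev <;>
    rcases mono_or_cross (σ := σ) hvw with hvw | hvw <;>
    rcases mono_or_cross (σ := σ) hwf with hwf | hwf
  · obtain rfl := mono_unique hG hσ hev.symm hvw
    exact far1 hwf.1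
  · obtain rfl := mono_unique hG hσ hev.symm hvw
    exact far1 hwf.1
  · obtain rfl := mono_unique hG hσ hme hev
    obtain rfl := mono_unique hG hσ hmf hwf.symm
    exact k4.1 hvw
  · obtain rfl := mono_unique hG hσ hme hev
    exact k2.2 w hvw hwf
  · obtain rfl := mono_unique hG hσ hvw.symm hwf
    exact far1 hev.1
  · have hncr := fun {x y} => Blocked.not_cross (x := x) (y := y) hG hσ hmfX hR hR' hd
    have hdR := Blocked.inDom_left hG hσ hmfX hR hR'
    have hdR' := Blocked.inDom_right hG hσ hmfX hR hR'
    have hwR : w ∉ R := fun h => hncr h hR'.mem hwf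
    have hvR' : v ∉ R' := fun h => hncr hR.mem h hev
    by_cases hvR : v ∈ R
    · by_cases hwR' : w ∈ R'
      · exact hmfX v (hdR v hvR hvw.covered) w (hdR' w hwR' hvw.covered_right) hvw
      · obtain ⟨z, hz, hwz⟩ := exists_mate_of_cross hG hσ (hdR'.mateFree hmfX) hR'.excess_le
          hvw.covered_right hwR' hR'.mem hwf
        exact hvR' (mono_unique hG hσ hwz hvw.symm ▸ hz)
    · obtain ⟨z, hz, hvz⟩ := exists_mate_of_cross hG hσ (hdR.mateFree hmfX) hR.excess_le
        hvw.covered hvR hR.mem hev.symm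
      exact hwR (mono_unique hG hσ hvz hvw ▸ hz)
  · obtain rfl := mono_unique hG hσ hmf hwf.symm
    exact k3.2 v hev hvw
  · have hncr := fun {x y} => Blocked.not_cross (x := x) (y := y) hG hσ hmfX hR hR' hd
    have hncom := fun {x y v} =>
      Blocked.not_common (x := x) (y := y) (v := v) hG hσ hmfX hR hR' hd
    have hv := Blocked.not_covered hG hσ hmfX hR hR' hd hme.covered hev hvw hwf
    have hmfX' := mateFree_insert_insert hG hσ hXmf hmf hfX' hme heX' hne1.symm
    have hw := Blocked.not_covered hG hσ hmfX' hR' hR hd.symm hmf.covered hwf.symm hvw.symm hev.symm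
    refine h.not_path hG (mateFree_insert_insert hG hσ hY.mateFree hme he' hmf hf' hef')
      hme.covered hmf.covered hef (hR.mono core_subset) (hR'.mono core_subset) hd hev hvw hwf hv hw
      ?_ ?_ (fun h => ⟨he h, hRp h⟩) (fun h => ⟨hf h, hRp' h⟩)
    · rw [Finset.mem_union, not_or]
      exact ⟨fun h => hncom h hR'.mem hvw.symm hwf, fun h => hncr hR.mem h hev⟩
    · rw [Finset.mem_union, not_or]
      exact ⟨fun h => hncr h hR'.mem hwf, fun h => hncom hR.mem h hev.symm hvw⟩

/-- A path through the mate of one end would make that end a source, unless the ends are adjacent. A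
bichromatic path through a covered vertex would make the ends mates. -/
lemma Optimal.linked (hG : G.IsSubcubic) (h : Optimal G σ Y) (hx : x ∈ core G σ Y)
    (hy : y ∈ core G σ Y) (hxy : x ≠ y) (hadj : G.Adj x y ∨ ∃ v, G.Adj x v ∧ G.Adj v y) :
    Linked G σ x y := by
  have hσ := h.isMaxCut
  have hY := h.admissible
  obtain ⟨hxY, hxs⟩ := mem_core.1 hx
  obtain ⟨hyY, hys⟩ := mem_core.1 hy
  rcases hadj with hadj | ⟨v, hxv, hvy⟩
  · rcases mono_or_cross (σ := σ) hadj with hm | hc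
    · exact absurd hm (hY.mateFree x hxY y hyY)
    · exact .inl hc
  rcases mono_or_cross (σ := σ) hxv with hxv | hxv <;>
    rcases mono_or_cross (σ := σ) hvy with hvy | hvy
  · exact absurd (mono_unique hG hσ hxv.symm hvy) hxy
  · by_contra hn
    exact hxs ⟨hxY, v, y, hxv, hyY, hvy, fun hc => hn (.inl hc)⟩
  · by_contra hn
    exact hys ⟨hyY, v, x, hvy.symm, hxY, hxv.symm, fun hc => hn (.inl hc.symm)⟩
  · by_cases hv : Covered G σ v
    · exact absurd (mono_of_cross_of_cross hG hσ (hY.covered x hxY) hv (hY.covered y hyY) hxv hvy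
        hxy) (hY.mateFree x hxY y hyY)
    · exact .inr ⟨v, hv, hxv.symm, hvy⟩

/-- Finite subcubic graphs are `(1, 1, 2, 2, 3)`-colourable. -/
theorem exists_coloring_of_fintype (hG : G.IsSubcubic) :
    ∃ c : V → Fin 5, ∀ u v, u ≠ v → c u = c v → Separated G (c u) u v := by
  classical
  obtain ⟨σ, Y, h⟩ := exists_optimal G
  have hσ := h.isMaxCut
  have hY := h.admissible
  obtain ⟨b, hb⟩ := exists_two_coloring (r := Linked G σ) (fun _ _ h => h.symm) (core G σ Y)
    fun C hC hne => exists_linked_le_one hG hσ hY (hC.trans core_subset) hne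
  -- `P` picks one end of each monochromatic edge that misses the core: the source if there is one,
  -- else the end that comes first in the arbitrary order `φ`.
  let φ := Fintype.equivFin V
  let P : V → Prop := fun e => ∃ e', Mono G σ e e' ∧ e' ∉ Y ∧
    (Source G σ Y e ∨ e ∉ Y ∧ φ e < φ e')
  let c : V → Fin 5 := fun x => if P x then 4 else if x ∈ core G σ Y then (if b x then 2 else 3)
    else if σ x then 0 else 1
  have hPY : ∀ {e}, P e → e ∈ Y → Source G σ Y e := by
    rintro e ⟨e', -, -, hs | hs⟩ heY
    · exact hs
    · exact absurd heY hs.1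
  have h4 : ∀ {x}, c x = 4 → P x := by
    intro x hx
    by_contra hP
    simp only [c, hP, if_false] at hx
    split_ifs at hx <;> exact absurd hx (by decide)
  have h2 : ∀ {x}, 2 ≤ c x → P x ∨ x ∈ core G σ Y := by
    intro x hx
    by_contra! hP
    simp only [c, hP, if_false] at hx
    split_ifs at hx <;> exact absurd hx (by decide)
  have hPP : ∀ {u v}, u ≠ v → P u → P v → Separated G 4 u v := by
    rintro u v huv hu hv
    obtain ⟨u', hmu, hu', hu''⟩ := id hu
    obtain ⟨v', hmv, hv', hv''⟩ := id hv
    refine h.separated hG huv ?_ hmu hmv hu' hv' (hPY hu) (hPY hv)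
    rintro rfl
    obtain rfl := mono_unique hG hσ hmu.symm hmv
    rcases hu'' with hu'' | hu''
    · exact hv' hu''.1
    rcases hv'' with hv'' | hv''
    · exact hu' hv''.1
    · exact absurd hu''.2 hv''.2.asymm
  refine ⟨c, fun u v huv huvc => ?_⟩
  by_cases hPu : P u
  · have hcu : c u = 4 := if_pos hPu
    rw [hcu]
    exact hPP huv hPu (h4 (huvc ▸ hcu))
  have hcu4 : c u ≠ 4 := fun h => hPu (h4 h)
  have hPv : ¬ P v := fun hPv => hcu4 (huvc.trans (if_pos hPv))
  by_cases huX : u ∈ core G σ Y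
  · have hcu : c u = if b u then 2 else 3 := by simp [c, hPu, huX]
    have hvX : v ∈ core G σ Y := by
      refine (h2 ?_).resolve_left hPv
      rw [← huvc, hcu]
      split_ifs <;> decide
    have hcv : c v = if b v then 2 else 3 := by simp [c, hPv, hvX]
    have hbuv : b u = b v := by
      rw [hcu, hcv] at huvc
      cases hbu : b u <;> cases hbv : b v <;> simp [hbu, hbv] at huvc ⊢
    have hnl : ¬ Linked G σ u v := fun hl => hb u huX v hvX huv hl hbuv
    exact ⟨fun ha => hnl (h.linked hG huX hvX huv (.inl ha)),
      fun _ a h1 h2 => hnl (h.linked hG huX hvX huv (.inr ⟨a, h1, h2⟩)),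
      fun h => absurd h hcu4⟩
  · have hvX : v ∉ core G σ Y := by
      intro hvX
      have hcv : c v = if b v then 2 else 3 := by simp [c, hPv, hvX]
      refine ((h2 (x := u) ?_).resolve_left hPu |> huX)
      rw [huvc, hcv]
      split_ifs <;> decide
    have hcu : c u = if σ u then 0 else 1 := by simp [c, hPu, huX]
    have hcv : c v = if σ v then 0 else 1 := by simp [c, hPv, hvX]
    have hσuv : σ u = σ v := by
      rw [hcu, hcv] at huvc
      cases hbu : σ u <;> cases hbv : σ v <;> simp [hbu, hbv] at huvc ⊢
    have hlt : ¬ 2 ≤ c u := by rw [hcu]; split_ifs <;> decide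
    refine ⟨fun ha => ?_, fun h => absurd h hlt, fun h => absurd h hcu4⟩
    have hm : Mono G σ u v := ⟨ha, hσuv⟩
    by_cases huY : u ∈ Y
    · have hs : Source G σ Y u := by_contra fun hs => huX (mem_core.2 ⟨huY, hs⟩)
      exact hPu ⟨v, hm, fun hvY => hY.mateFree u huY v hvY hm, .inl hs⟩
    by_cases hvY : v ∈ Y
    · have hs : Source G σ Y v := by_contra fun hs => hvX (mem_core.2 ⟨hvY, hs⟩)
      exact hPv ⟨u, hm.symm, huY, .inl hs⟩
    rcases lt_or_gt_of_ne (fun h => huv (φ.injective h) : φ u ≠ φ v) with hlt | hlt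
    · exact hPu ⟨v, hm, hvY, .inr ⟨huY, hlt⟩⟩
    · exact hPv ⟨u, hm.symm, huY, .inr ⟨hvY, hlt⟩⟩

end SubcubicPacking

namespace SubcubicPacking

variable {V : Type*} {G : SimpleGraph V}

/-! ### From finite to infinite graphs -/

lemma IsSubcubic.induce (hG : G.IsSubcubic) (s : Set V) : (G.induce s).IsSubcubic := by
  intro v
  refine le_trans ?_ (hG v)
  rw [← (Subtype.val_injective : Function.Injective (Subtype.val : s → V)).encard_image]
  refine Set.encard_le_encard ?_
  rintro _ ⟨w, hw, rfl⟩
  exact hw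

/-- Compactness, by Rado's selection principle. The inner vertices of a path of length at most three
from `u` to `v` are neighbours of `u` or `v`, so a finite induced subgraph containing these
neighbourhoods decides `Separated`; the default colour 0 is never read. -/
theorem exists_coloring (hG : G.IsSubcubic) :
    ∃ c : V → Fin 5, ∀ u v, u ≠ v → c u = c v → Separated G (c u) u v := by
  classical
  choose d hd using fun F : Finset V =>
    exists_coloring_of_fintype (IsSubcubic.induce hG (F : Set V))
  obtain ⟨c, hc⟩ := Finset.rado_selection (β := fun _ : V => Fin 5)
    fun F x => if hx : x ∈ (F : Set V) then d F ⟨x, hx⟩ else 0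
  refine ⟨c, fun u v huv hcuv => ?_⟩
  have hfin : ∀ w, (G.neighborSet w).Finite := fun w =>
    Set.finite_of_encard_le_coe (hG w)
  obtain ⟨t, hst, ht⟩ := hc ({u, v} ∪ (hfin u).toFinset ∪ (hfin v).toFinset)
  have hu : u ∈ (t : Set V) := hst (by simp)
  have hv : v ∈ (t : Set V) := hst (by simp)
  have hNu : ∀ a, G.Adj u a → a ∈ (t : Set V) := fun a ha => hst (by simp [ha])
  have hNv : ∀ a, G.Adj a v → a ∈ (t : Set V) := fun a ha => hst (by simp [ha.symm])
  have hcu : c u = d t ⟨u, hu⟩ := by simpa [Finset.mem_coe.1 hu] using ht u (by simp)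
  have hcv : c v = d t ⟨v, hv⟩ := by simpa [Finset.mem_coe.1 hv] using ht v (by simp)
  obtain ⟨h1, h2, h3⟩ := hd t ⟨u, hu⟩ ⟨v, hv⟩ (by simpa using huv) (by rw [← hcu, ← hcv, hcuv])
  rw [← hcu] at h2 h3
  exact ⟨h1, fun hi a hua hav => h2 hi ⟨a, hNu a hua⟩ hua hav,
    fun hi a b hua hab hbv => h3 hi ⟨a, hNu a hua⟩ ⟨b, hNv b hbv⟩ hua hab hbv⟩

/-! ### Walks in the subdivided graph -/

/-- The vertices of `G` that a vertex of the subdivided graph stands for. -/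
def ends (G : SimpleGraph V) : V ⊕ G.edgeSet → V → Prop
  | .inl u, w => w = u
  | .inr e, w => w ∈ e.1

/-- The number of steps from a vertex of the subdivided graph to its ends. -/
def offset (G : SimpleGraph V) : V ⊕ G.edgeSet → ℕ
  | .inl _ => 0
  | .inr _ => 1

/-- Passing a subdivision vertex takes two steps and either traverses one edge of `G` or returns;
`offset` accounts for the half edge when the walk starts at a subdivision vertex. -/
lemma exists_walk_of_subdivided {x y : V ⊕ G.edgeSet} (p : G.subdivided.Walk x y) {v : V}
    (hy : y = .inl v) : ∃ u, ends G x u ∧ ∃ q : G.Walk u v, 2 * q.length + offset G x ≤ p.length := by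
  induction p with
  | nil => subst hy; exact ⟨v, rfl, .nil, by simp [offset]⟩
  | @cons x x' y h p ih =>
    obtain ⟨u, hu, q, hq⟩ := ih hy
    rcases x with w | e <;> rcases x' with w' | e'
    · exact h.elim
    · refine ⟨w, rfl, ?_⟩
      by_cases hwu : w = u
      · subst hwu
        exact ⟨q, by simp only [offset, SimpleGraph.Walk.length_cons] at hq ⊢; omega⟩
      · have hadj : G.Adj w u := by
          have he : e'.1 = s(w, u) := (Sym2.mem_and_mem_iff hwu).1 ⟨h, hu⟩
          exact (SimpleGraph.mem_edgeSet G).1 (he ▸ e'.2)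
        exact ⟨.cons hadj q, by simp only [offset, SimpleGraph.Walk.length_cons] at hq ⊢; omega⟩
    · obtain rfl : u = w' := hu
      exact ⟨u, h, q, by simp only [offset, SimpleGraph.Walk.length_cons] at hq ⊢; omega⟩
    · exact h.elim

lemma Separated.lt_length {i : Fin 5} {u v : V} (h : Separated G i u v) (huv : u ≠ v)
    (q : G.Walk u v) : ![1, 1, 2, 2, 3] i < q.length := by
  obtain ⟨h1, h2, h3⟩ := h
  rcases q with _ | ⟨ha, _ | ⟨hb, _ | ⟨hc, _ | ⟨hd, q⟩⟩⟩⟩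
  · exact absurd rfl huv
  · exact absurd ha h1
  · fin_cases i
    · simp
    · simp
    all_goals exact absurd hb (h2 (by decide) _ ha)
  · fin_cases i
    · simp
    · simp
    · simp
    · simp
    · exact absurd hc (h3 rfl _ _ ha hb)
  · simp only [SimpleGraph.Walk.length_cons]
    fin_cases i <;> simp

/-- The colouring of the subdivided graph that extends a colouring of the original vertices. -/
def subdividedColoring (c : V → Fin 5) : V ⊕ G.edgeSet → Fin 6
  | .inl v => (c v).succ
  | .inr _ => 0

lemma lt_edist_of_forall_walk {W : Type*} {H : SimpleGraph W} {x y : W} {n : ℕ}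
    (h : ∀ p : H.Walk x y, n < p.length) : (n : ℕ∞) < H.edist x y := by
  by_contra hn
  obtain ⟨p, hp⟩ := SimpleGraph.exists_walk_of_edist_ne_top (G := H) (u := x) (v := y)
    (ne_top_of_le_ne_top (ENat.natCast_ne_top n) (not_lt.1 hn))
  rw [← hp] at hn
  exact hn (by exact_mod_cast h p)

lemma isPackingColoring_subdividedColoring {c : V → Fin 5}
    (hc : ∀ u v, u ≠ v → c u = c v → Separated G (c u) u v) :
    G.subdivided.IsPackingColoring ![1, 3, 3, 5, 5, 7] (subdividedColoring c) := by
  rintro (u | e) (v | f) hne hcol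
  · refine lt_edist_of_forall_walk fun p => ?_
    have huv : u ≠ v := fun h => hne (h ▸ rfl)
    obtain ⟨w, hw, q, hq⟩ := exists_walk_of_subdivided p rfl
    obtain rfl : w = u := hw
    have hs := (hc _ v huv (Fin.succ_injective _ hcol)).lt_length huv q
    simp only [offset, subdividedColoring] at hq ⊢
    generalize c w = i at hs ⊢
    fin_cases i <;> simp at hs ⊢ <;> omega
  · exact absurd hcol (Fin.succ_ne_zero _)
  · exact absurd hcol.symm (Fin.succ_ne_zero _)
  · refine lt_edist_of_forall_walk fun p => ?_
    rcases p with _ | ⟨h, _ | ⟨h', p⟩⟩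
    · exact absurd rfl hne
    · exact h.elim
    · simp [subdividedColoring]

end SubcubicPacking

theorem mainTheorem9 {V : Type*} (G : SimpleGraph V) (hG : G.IsSubcubic) :
    G.subdivided.PackingColorable ![1, 3, 3, 5, 5, 7] ∧
      G.subdivided.packingChromaticNumber ≤ 6 := by
  obtain ⟨c, hc⟩ := SubcubicPacking.exists_coloring hG
  have h := SubcubicPacking.isPackingColoring_subdividedColoring hc
  refine ⟨⟨_, h⟩, iInf₂_le (6 : ℕ) ⟨SubcubicPacking.subdividedColoring c, fun u v huv hcol => ?_⟩⟩
  -- The sequence 1, 3, 3, 5, 5, 7 dominates 1, 2, 3, 4, 5, 6 termwise, so the same colouring works.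
  refine lt_of_le_of_lt (Nat.cast_le.2 ?_) (h u v huv hcol)
  generalize SubcubicPacking.subdividedColoring c u = i
  fin_cases i <;> decide
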